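/- Let $ABC$ be a non-degenerate, non-obtuse triangle in the Euclidean plane with edge lengths $a=BC\ge b=CA\ge c=AB$ and area $\tau$. For a point $S$ on the perimeter of $ABC$ (the union of its three closed edges), a feasible solution with starting point $S$ is a pair of unit-speed trajectories in the plane, parametrized by time $t\ge 0$, of two agents that both start at $S$ at time $0$ and such that every point of the perimeter is eventually visited by at least one of them. Its evacuation cost is the supremum, over all points $T$ of the perimeter, of the first time at which $T$ is visited by an agent plus the distance at that time from $T$ to the other agent. Let $\mathrm{opt}(S)$ be the infimum of the evacuation costs of the feasible solutions with starting point $S$. With $e$ ranging over the three edges of $ABC$, put $$\underline{\mathcal L}=\min_{e}\inf_{S\in e}\mathrm{opt}(S),\quad \overline{\mathcal L}=\max_{e}\inf_{S\in e}\mathrm{opt}(S),\quad \underline{\mathcal U}=\min_{e}\sup_{S\in e}\mathrm{opt}(S),\quad \overline{\mathcal U}=\max_{e}\sup_{S\in e}\mathrm{opt}(S);$$ these are the optimal costs when (edge, starting point on that edge) are chosen by (algorithm, algorithm), (adversary, algorithm), (algorithm, adversary) and (adversary, adversary), respectively. Then $$\underline{\mathcal L}=\frac{a+b+c}{2},$$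 $$\frac{a+b+c}{2}\le\overline{\mathcal L}\le\min\left\{b+c,\ \frac{(a+b)^2-c^2+4\sqrt3\,\tau}{4b}\right\},$$ $$\min\left\{\frac12\sqrt{\frac{2b^2(a-c)-(a-2c)(a+c)^2}{a}}+b,\ a+c\right\}\le\underline{\mathcal U}\le\min\left\{\frac a2+b+\frac c2,\ a+c\right\},$$ $$a+\frac12\sqrt{\frac{2a^2(b-c)-(b-2c)(b+c)^2}{b}}\le\overline{\mathcal U}\le a+\frac{b+c}{2}.$$ -/

import Mathlib

open scoped ENNReal

namespace TriangleEvacuation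

/-- The Euclidean plane. -/
abbrev Plane : Type := EuclideanSpace ℝ (Fin 2)

/-- The three (closed) edges of the triangle `ABC`; edge `i` is opposite to the `i`-th vertex. -/
def edge (A B C : Plane) : Fin 3 → Set Plane :=
  ![segment ℝ B C, segment ℝ C A, segment ℝ A B]

/-- The perimeter of the triangle `ABC`, i.e. the union of its edges. -/
def perimeter (A B C : Plane) : Set Plane :=
  ⋃ i, edge A B C i

/-- The set of all times `t ≥ 0` at which at least one of the two agents is located at `P`. -/
def visitTimes (r₁ r₂ : ℝ → Plane) (P : Plane) : Set ℝ :=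
  {t | 0 ≤ t ∧ (r₁ t = P ∨ r₂ t = P)}

/-- A feasible solution with starting point `S`: two unit-speed trajectories in the plane
(parametrized by the time `t ≥ 0`), both starting at `S`, such that every point of the perimeter
is eventually visited by an agent. -/
structure IsFeasible (A B C S : Plane) (r₁ r₂ : ℝ → Plane) : Prop where
  start₁ : r₁ 0 = S
  start₂ : r₂ 0 = S
  speed₁ : HasUnitSpeedOn r₁ (Set.Ici 0)
  speed₂ : HasUnitSpeedOn r₂ (Set.Ici 0)
  covers : ∀ P ∈ perimeter A B C, (visitTimes r₁ r₂ P).Nonempty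

/-- The evacuation time when the exit is at `P`: the first time `t` at which `P` is visited by an
agent, plus the distance at time `t` between `P` and the other agent. (One of the two agents is at
`P` at that time, so the distance of the other one is the larger of the two distances.) It is
`∞` if `P` is never visited. -/
noncomputable def evacuationTime (r₁ r₂ : ℝ → Plane) (P : Plane) : ℝ≥0∞ :=
  ⨅ (t : ℝ) (_ : IsLeast (visitTimes r₁ r₂ P) t),
    ENNReal.ofReal (t + max (dist (r₁ t) P) (dist (r₂ t) P))

/-- The (worst-case) evacuation cost of a pair of trajectories: the supremum of the evacuation
times over all placements of the exit on the perimeter. -/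
noncomputable def evacuationCost (A B C : Plane) (r₁ r₂ : ℝ → Plane) : ℝ≥0∞ :=
  ⨆ P ∈ perimeter A B C, evacuationTime r₁ r₂ P

/-- The best evacuation cost over all feasible solutions with starting point `S`. -/
noncomputable def optimalCost (A B C S : Plane) : ℝ≥0∞ :=
  ⨅ (r₁ : ℝ → Plane) (r₂ : ℝ → Plane) (_ : IsFeasible A B C S r₁ r₂), evacuationCost A B C r₁ r₂

/-- Optimal cost when the algorithm chooses the starting edge and the starting point on it. -/
noncomputable def lowerL (A B C : Plane) : ℝ≥0∞ :=
  ⨅ i : Fin 3, ⨅ S ∈ edge A B C i, optimalCost A B C S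

/-- Optimal cost when the adversary chooses the starting edge and then the algorithm chooses the
starting point on it. -/
noncomputable def upperL (A B C : Plane) : ℝ≥0∞ :=
  ⨆ i : Fin 3, ⨅ S ∈ edge A B C i, optimalCost A B C S

/-- Optimal cost when the algorithm chooses the starting edge and then the adversary chooses the
starting point on it. -/
noncomputable def lowerU (A B C : Plane) : ℝ≥0∞ :=
  ⨅ i : Fin 3, ⨆ S ∈ edge A B C i, optimalCost A B C S

/-- Optimal cost when the adversary chooses the starting edge and the starting point on it. -/
noncomputable def upperU (A B C : Plane) : ℝ≥0∞ :=
  ⨆ i : Fin 3, ⨆ S ∈ edge A B C i, optimalCost A B C S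

/-- The area of the triangle `ABC`, as the Lebesgue measure of the solid triangle. -/
noncomputable def area (A B C : Plane) : ℝ :=
  (MeasureTheory.volume (convexHull ℝ {A, B, C} : Set Plane)).toReal

end TriangleEvacuation

namespace TriangleEvacuation

variable {A B C S : Plane} {r₁ r₂ : ℝ → Plane}

/-! Lower bounds have two sources. Two unit-speed paths that cover the perimeter need half its
length each on average (`half_perimeter_le_optimalCost`). If `U` and `V` are both at distance at
least `m` from `S`, the agent that reaches the first of them is still too far from the other one
when that one is first visited, which costs at least `m + UV` (`dist_add_le_optimalCost`); this is
applied at vertices and at well-chosen points of an edge.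

All upper bounds come from one search: the agents traverse the perimeter in opposite directions
until they meet (`optimalCost_le_of_opposite`). Its cost is the maximum of `t` plus their distance
at time `t`. While each agent stays on one edge this is a convex function of `t`, so only the times
at which an agent turns a corner matter (`IsUnitAffineOn.add_dist_le`). At other times it suffices
that the distance is at most the longest edge and at most the unexplored length.

For a good start on `BC`, let `P` on `CA` be the position of one agent when the other reaches `B`,
and put `p = AP`. The cost is then governed by `(a + b - p) / 2 + BP`
(`optimalCost_le_of_balanced`), whose derivative in `p` vanishes where `BP` meets `CA` at 60°; this
gives the bound with the area. If the angle at `A` is at most 60°, then `p = c` already attains half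
the perimeter. The angle opposite the shortest edge always qualifies, which settles the first
equality. -/

/-! ### Unit-speed trajectories and first visits. -/

lemma dist_le_of_hasUnitSpeedOn {r : ℝ → Plane} (h : HasUnitSpeedOn r (Set.Ici 0)) {x y : ℝ}
    (hx : 0 ≤ x) (hxy : x ≤ y) : dist (r x) (r y) ≤ y - x := by
  have h1 := h (x := x) hx (y := y) (hx.trans hxy : 0 ≤ y)
  have h2 : edist (r x) (r y) ≤ eVariationOn r (Set.Ici 0 ∩ Set.Icc x y) :=
    eVariationOn.edist_le r ⟨hx, le_refl x, hxy⟩ ⟨(hx.trans hxy : 0 ≤ y), hxy, le_refl y⟩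
  rw [h1, edist_dist] at h2
  have := (ENNReal.ofReal_le_ofReal_iff (by simpa using hxy)).1 h2
  simpa using this

lemma lipschitzOnWith_of_hasUnitSpeedOn {r : ℝ → Plane} (h : HasUnitSpeedOn r (Set.Ici 0)) :
    LipschitzOnWith 1 r (Set.Ici 0) := by
  refine LipschitzOnWith.of_dist_le_mul fun x hx y hy => ?_
  rcases le_total x y with hxy | hxy
  · have := dist_le_of_hasUnitSpeedOn h hx hxy
    rw [Real.dist_eq, abs_sub_comm, abs_of_nonneg (by linarith)]
    simpa using this
  · have := dist_le_of_hasUnitSpeedOn h hy hxy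
    rw [dist_comm, Real.dist_eq, abs_of_nonneg (by linarith)]
    simpa using this

/-- Continuity makes the set of visit times closed. Without a least element, `evacuationTime` would
be an infimum over nothing, i.e. `⊤`. -/
lemma IsFeasible.exists_isLeast (h : IsFeasible A B C S r₁ r₂) {P : Plane}
    (hP : P ∈ perimeter A B C) : ∃ t, IsLeast (visitTimes r₁ r₂ P) t := by
  have hclosed : IsClosed (visitTimes r₁ r₂ P) := by
    have h1 := (lipschitzOnWith_of_hasUnitSpeedOn h.speed₁).continuousOn.preimage_isClosed_of_isClosed
      isClosed_Ici (isClosed_singleton (x := P))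
    have h2 := (lipschitzOnWith_of_hasUnitSpeedOn h.speed₂).continuousOn.preimage_isClosed_of_isClosed
      isClosed_Ici (isClosed_singleton (x := P))
    convert h1.union h2 using 1
    ext t
    simp only [visitTimes, Set.mem_ofPred_eq, Set.mem_union, Set.mem_inter_iff, Set.mem_Ici,
      Set.mem_preimage, Set.mem_singleton_iff]
    tauto
  have hbdd : BddBelow (visitTimes r₁ r₂ P) := ⟨0, fun t ht => ht.1⟩
  exact ⟨_, hclosed.csInf_mem (h.covers P hP) hbdd, fun t ht => csInf_le hbdd ht⟩

lemma evacuationTime_eq_of_isLeast {P : Plane} {t : ℝ} (ht : IsLeast (visitTimes r₁ r₂ P) t) :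
    evacuationTime r₁ r₂ P = ENNReal.ofReal (t + max (dist (r₁ t) P) (dist (r₂ t) P)) := by
  refine le_antisymm (iInf₂_le t ht) (le_iInf₂ fun s hs => ?_)
  rw [hs.unique ht]

lemma ofReal_le_evacuationCost {P : Plane} (hP : P ∈ perimeter A B C) {t K : ℝ}
    (ht : IsLeast (visitTimes r₁ r₂ P) t) (hK : K ≤ t + max (dist (r₁ t) P) (dist (r₂ t) P)) :
    ENNReal.ofReal K ≤ evacuationCost A B C r₁ r₂ := by
  refine le_trans ?_ (le_iSup₂_of_le P hP le_rfl)
  rw [evacuationTime_eq_of_isLeast ht]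
  exact ENNReal.ofReal_le_ofReal hK

/-! ### Lower bounds. -/

/-- If two points of the perimeter are at distance at least `m` from the starting point, then the
evacuation cost is at least `m` plus the distance between them. -/
theorem dist_add_le_optimalCost {U V : Plane} (hU : U ∈ perimeter A B C)
    (hV : V ∈ perimeter A B C) {m : ℝ} (hSU : m ≤ dist S U) (hSV : m ≤ dist S V) :
    ENNReal.ofReal (dist U V + m) ≤ optimalCost A B C S := by
  refine le_iInf fun r₁ => le_iInf fun r₂ => le_iInf fun h => ?_
  -- With `U` visited first, its visitor is within `s - t` of `U` at time `s`, hence at least `UV -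
  -- (s - t)` from `V`; and `t ≥ m` because `U` is that far from `S`.
  have key : ∀ U V : Plane, V ∈ perimeter A B C → m ≤ dist S U →
      ∀ t s, IsLeast (visitTimes r₁ r₂ U) t → IsLeast (visitTimes r₁ r₂ V) s → t ≤ s →
      ENNReal.ofReal (dist U V + m) ≤ evacuationCost A B C r₁ r₂ := by
    intro U V hV hSU t s ht hs hts
    refine ofReal_le_evacuationCost hV hs ?_
    have ht0 := ht.1.1
    rcases ht.1.2 with h1 | h1
    · have e1 := dist_le_of_hasUnitSpeedOn h.speed₁ le_rfl ht0
      have e2 := dist_le_of_hasUnitSpeedOn h.speed₁ ht0 hts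
      rw [h1, h.start₁] at e1
      rw [h1] at e2
      have := dist_triangle U (r₁ s) V
      have := le_max_left (dist (r₁ s) V) (dist (r₂ s) V)
      linarith
    · have e1 := dist_le_of_hasUnitSpeedOn h.speed₂ le_rfl ht0
      have e2 := dist_le_of_hasUnitSpeedOn h.speed₂ ht0 hts
      rw [h1, h.start₂] at e1
      rw [h1] at e2
      have := dist_triangle U (r₂ s) V
      have := le_max_right (dist (r₁ s) V) (dist (r₂ s) V)
      linarith
  obtain ⟨t, ht⟩ := h.exists_isLeast hU
  obtain ⟨s, hs⟩ := h.exists_isLeast hV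
  rcases le_total t s with hts | hts
  · exact key U V hV hSU t s ht hs hts
  · rw [dist_comm]
    exact key V U hU hSV s t hs ht hts

-- By affine independence two edges share only a vertex, which is a null set for `μH[1]`, so the
-- lengths add up.
open MeasureTheory Measure in
lemma le_hausdorffMeasure_perimeter (hABC : AffineIndependent ℝ ![A, B, C]) :
    ENNReal.ofReal (dist B C + dist C A + dist A B) ≤ μH[1] (perimeter A B C) := by
  have hinj : A ≠ B ∧ B ≠ C ∧ C ≠ A := by
    have := hABC.injective
    refine ⟨fun h => ?_, fun h => ?_, fun h => ?_⟩
    · exact absurd (this (a₁ := 0) (a₂ := 1) (by simpa using h)) (by decide)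
    · exact absurd (this (a₁ := 1) (a₂ := 2) (by simpa using h)) (by decide)
    · exact absurd (this (a₁ := 2) (a₂ := 0) (by simpa using h)) (by decide)
  have hind := hABC.range
  have hclosed : ∀ X Y : Plane, MeasurableSet (segment ℝ X Y) := fun X Y => by
    rw [segment_eq_image_lineMap]
    exact (isCompact_Icc.image AffineMap.lineMap_continuous).isClosed.measurableSet
  have hinter : ∀ X Y Z : Plane, X ≠ Y → Y ≠ Z → Z ≠ X → Set.range ![A, B, C] = {X, Y, Z} →
      segment ℝ X Y ∩ segment ℝ Y Z ⊆ {Y} := by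
    classical
    intro X Y Z h1 h2 h3 hr
    rw [hr] at hind
    have := AffineIndependent.convexHull_inter (R := ℝ) (s := ({X, Y, Z} : Finset Plane))
      (t₁ := {X, Y}) (t₂ := {Y, Z}) (by
        have e : ((({X, Y, Z} : Finset Plane)) : Set Plane) = {X, Y, Z} := by simp
        rw [← e] at hind; exact hind)
      (by intro x; simp; tauto) (by intro x; simp; tauto)
    rw [← convexHull_pair, ← convexHull_pair]
    have h4 : (({X, Y} ∩ {Y, Z} : Finset Plane)) = {Y} := by
      ext x
      simp only [Finset.mem_inter, Finset.mem_insert, Finset.mem_singleton]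
      constructor
      · rintro ⟨h5 | h5, h6 | h6⟩
        exacts [h6, absurd (h6.symm.trans h5) h3, h5, h5]
      · intro h5; simp [h5]
    rw [← Finset.coe_inter, h4] at this
    simp only [Finset.coe_insert, Finset.coe_singleton, convexHull_singleton] at this
    exact this.symm.le
  have hrange : Set.range ![A, B, C] = {A, B, C} := by
    simp [Matrix.range_cons, Set.insert_def]
    ext; simp; tauto
  obtain ⟨hAB, hBC, hCA⟩ := hinj
  have := nullSingletonClass_hausdorff Plane one_pos
  have e1 : perimeter A B C = segment ℝ B C ∪ (segment ℝ C A ∪ segment ℝ A B) := by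
    ext x; simp [perimeter, edge, Fin.exists_fin_succ]
  have e2 : μH[1] (segment ℝ C A ∩ segment ℝ A B) = 0 := measure_mono_null
    (hinter C A B hCA hAB hBC (by rw [hrange]; ext; simp; tauto)) (measure_singleton A)
  have e3 : μH[1] (segment ℝ B C ∩ (segment ℝ C A ∪ segment ℝ A B)) = 0 := by
    rw [Set.inter_union_distrib_left]
    refine measure_union_null (measure_mono_null
      (hinter B C A hBC hCA hAB (by rw [hrange]; ext; simp; tauto)) (measure_singleton C)) ?_
    rw [Set.inter_comm]
    exact measure_mono_null (hinter A B C hAB hBC hCA hrange) (measure_singleton B)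
  rw [e1, measure_union₀' (hclosed B C).nullMeasurableSet e3,
    measure_union₀' (hclosed C A).nullMeasurableSet e2, hausdorffMeasure_segment,
    hausdorffMeasure_segment, hausdorffMeasure_segment, ENNReal.ofReal_add (by positivity)
    (by positivity), ENNReal.ofReal_add (by positivity) (by positivity), edist_dist, edist_dist,
    edist_dist, add_assoc]

/-- By time `K`, the cost, everything has been visited, and each 1-Lipschitz image of `[0, K]` has
`μH[1]`-measure at most `K`. -/
theorem half_perimeter_le_optimalCost (hABC : AffineIndependent ℝ ![A, B, C]) (S : Plane) :
    ENNReal.ofReal ((dist B C + dist C A + dist A B) / 2) ≤ optimalCost A B C S := by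
  refine le_iInf fun r₁ => le_iInf fun r₂ => le_iInf fun h => ?_
  rcases eq_or_ne (evacuationCost A B C r₁ r₂) ⊤ with hT | hT
  · rw [hT]; exact le_top
  set K := (evacuationCost A B C r₁ r₂).toReal with hK
  have hsub : perimeter A B C ⊆ r₁ '' Set.Icc 0 K ∪ r₂ '' Set.Icc 0 K := by
    intro P hP
    obtain ⟨t, ht⟩ := h.exists_isLeast hP
    have h1 : ENNReal.ofReal t ≤ evacuationCost A B C r₁ r₂ :=
      ofReal_le_evacuationCost hP ht (by
        have h2 := le_max_left (dist (r₁ t) P) (dist (r₂ t) P)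
        have h3 : 0 ≤ dist (r₁ t) P := dist_nonneg
        linarith)
    have htK : t ≤ K := (ENNReal.ofReal_le_iff_le_toReal hT).1 h1
    rcases ht.1.2 with h2 | h2
    · exact Or.inl ⟨t, ⟨ht.1.1, htK⟩, h2⟩
    · exact Or.inr ⟨t, ⟨ht.1.1, htK⟩, h2⟩
  have himg : ∀ r : ℝ → Plane, HasUnitSpeedOn r (Set.Ici 0) →
      MeasureTheory.Measure.hausdorffMeasure 1 (r '' Set.Icc 0 K) ≤ ENNReal.ofReal K := by
    intro r hr
    have := ((lipschitzOnWith_of_hasUnitSpeedOn hr).mono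
      (Set.Icc_subset_Ici_self (a := K) (b := 0))).hausdorffMeasure_image_le (d := 1) zero_le_one
    rw [MeasureTheory.hausdorffMeasure_real] at this
    simpa using this
  have hK0 : 0 ≤ K := ENNReal.toReal_nonneg
  have h3 := (le_hausdorffMeasure_perimeter hABC).trans ((MeasureTheory.measure_mono hsub).trans
    ((MeasureTheory.measure_union_le _ _).trans (add_le_add (himg r₁ h.speed₁) (himg r₂ h.speed₂))))
  rw [← ENNReal.ofReal_add hK0 hK0, ENNReal.ofReal_le_ofReal_iff (by linarith)] at h3
  rw [ENNReal.ofReal_le_iff_le_toReal hT]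
  linarith

/-! ### Parametrization of the perimeter. -/

/-- `γ` traverses a straight line at unit speed as long as its parameter is in `s`. -/
def IsUnitAffineOn (γ : ℝ → Plane) (s : Set ℝ) : Prop :=
  ∃ p e : Plane, ‖e‖ = 1 ∧ ∀ x ∈ s, γ x = p + x • e

lemma IsUnitAffineOn.hasUnitSpeedOn {γ : ℝ → Plane} {s : Set ℝ} (h : IsUnitAffineOn γ s) :
    HasUnitSpeedOn γ s := by
  obtain ⟨p, e, he, h⟩ := h
  have hd : ∀ x ∈ s, ∀ y ∈ s, edist (γ x) (γ y) = edist x y := fun x hx y hy => by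
    rw [h x hx, h y hy, edist_add_left, edist_dist, edist_dist, dist_eq_norm, ← sub_smul, norm_smul,
      he, mul_one, dist_eq_norm]
  refine hasConstantSpeedOnWith_iff_ordered.2 fun x hx y hy hxy => ?_
  simp only [NNReal.coe_one, one_mul]
  refine le_antisymm ?_ ?_
  · have h1 : eVariationOn γ (s ∩ Set.Icc x y) ≤ eVariationOn id (s ∩ Set.Icc x y) := by
      have := LipschitzOnWith.comp_eVariationOn_le (f := γ) (g := id) (C := 1) (t := s)
        (s := s ∩ Set.Icc x y)
        (fun x hx y hy => by rw [hd x hx y hy]; simp) (fun x hx => hx.1)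
      simpa using this
    exact h1.trans (MonotoneOn.eVariationOn_eq monotoneOn_id hx hy).le
  · have h1 := eVariationOn.edist_le γ (s := s ∩ Set.Icc x y) (x := y) (y := x)
      ⟨hy, hxy, le_rfl⟩ ⟨hx, le_rfl, hxy⟩
    rwa [hd y hy x hx, edist_dist, Real.dist_eq, abs_of_nonneg (by linarith)] at h1

lemma IsUnitAffineOn.dist_le {γ : ℝ → Plane} {s t : Set ℝ} [s.OrdConnected] [t.OrdConnected]
    (hs : IsUnitAffineOn γ s) (ht : IsUnitAffineOn γ t) {x₀ x₁ y₀ y₁ θ : ℝ} (hx₀ : x₀ ∈ s)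
    (hx₁ : x₁ ∈ s) (hy₀ : y₀ ∈ t) (hy₁ : y₁ ∈ t) (h0 : 0 ≤ θ) (h1 : θ ≤ 1) :
    dist (γ ((1 - θ) * x₀ + θ * x₁)) (γ ((1 - θ) * y₀ + θ * y₁)) ≤
      (1 - θ) * dist (γ x₀) (γ y₀) + θ * dist (γ x₁) (γ y₁) := by
  have hx : (1 - θ) * x₀ + θ * x₁ ∈ s :=
    Set.OrdConnected.convex ‹_› hx₀ hx₁ (by linarith) h0 (by ring)
  have hy : (1 - θ) * y₀ + θ * y₁ ∈ t :=
    Set.OrdConnected.convex ‹_› hy₀ hy₁ (by linarith) h0 (by ring)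
  obtain ⟨p, e, -, hs⟩ := hs
  obtain ⟨q, f, -, ht⟩ := ht
  rw [hs _ hx, ht _ hy, hs _ hx₀, hs _ hx₁, ht _ hy₀, ht _ hy₁, dist_eq_norm, dist_eq_norm,
    dist_eq_norm]
  have : p + ((1 - θ) * x₀ + θ * x₁) • e - (q + ((1 - θ) * y₀ + θ * y₁) • f) =
      (1 - θ) • (p + x₀ • e - (q + y₀ • f)) + θ • (p + x₁ • e - (q + y₁ • f)) := by module
  rw [this]
  refine (norm_add_le _ _).trans ?_
  rw [norm_smul, norm_smul, Real.norm_of_nonneg h0, Real.norm_of_nonneg (by linarith)]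

/-- The perimeter of `ABC`, traversed at unit speed: from `C` (at `-BC`) to `B` (at `0`), then
to `A` (at `AB`), to `C` (at `AB + CA`) and to `B` again. -/
noncomputable def loop (A B C : Plane) (x : ℝ) : Plane :=
  if x ≤ 0 then B + (x / dist B C) • (B - C)
  else if x ≤ dist A B then B + (x / dist A B) • (A - B)
  else if x ≤ dist A B + dist C A then A + ((x - dist A B) / dist C A) • (C - A)
  else C + ((x - dist A B - dist C A) / dist B C) • (B - C)

lemma loop_of_nonpos {x : ℝ} (hx : x ≤ 0) :
    loop A B C x = B + (x / dist B C) • (B - C) := if_pos hx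

lemma loop_of_mem_fst {x : ℝ} (h0 : 0 ≤ x) (h1 : x ≤ dist A B) :
    loop A B C x = B + (x / dist A B) • (A - B) := by
  rcases h0.eq_or_lt with rfl | h0
  · simp [loop]
  · rw [loop, if_neg h0.not_ge, if_pos h1]

lemma loop_of_mem_snd (hAB : A ≠ B) {x : ℝ} (h0 : dist A B ≤ x)
    (h1 : x ≤ dist A B + dist C A) :
    loop A B C x = A + ((x - dist A B) / dist C A) • (C - A) := by
  have := dist_pos.2 hAB
  rcases h0.eq_or_lt with rfl | h0
  · rw [loop_of_mem_fst this.le le_rfl, div_self this.ne']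
    simp
  · rw [loop, if_neg (by linarith), if_neg (by linarith), if_pos h1]

lemma loop_of_ge (hAB : A ≠ B) (hCA : C ≠ A) {x : ℝ} (h0 : dist A B + dist C A ≤ x) :
    loop A B C x = C + ((x - dist A B - dist C A) / dist B C) • (B - C) := by
  have := dist_pos.2 hAB
  have h2 := dist_pos.2 hCA
  rcases h0.eq_or_lt with rfl | h0
  · rw [loop_of_mem_snd hAB (by linarith) le_rfl, add_sub_cancel_left, div_self h2.ne']
    simp
  · rw [loop, if_neg (by linarith), if_neg (by linarith), if_neg (by linarith)]

lemma isUnitAffineOn_of_eq {γ : ℝ → Plane} {s : Set ℝ} {X Y Z : Plane} {r d : ℝ} (hYZ : Y ≠ Z)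
    (hd : d = dist Y Z) (h : ∀ x ∈ s, γ x = X + ((x - r) / d) • (Y - Z)) : IsUnitAffineOn γ s := by
  subst hd
  have := dist_pos.2 hYZ
  refine ⟨X - (r / dist Y Z) • (Y - Z), (1 / dist Y Z) • (Y - Z), ?_, fun x hx => ?_⟩
  · rw [norm_smul, ← dist_eq_norm, Real.norm_of_nonneg (by positivity), one_div,
      inv_mul_cancel₀ this.ne']
  · rw [h x hx, sub_div, smul_smul, mul_one_div]
    module

lemma isUnitAffineOn_loop_Iic (hBC : B ≠ C) : IsUnitAffineOn (loop A B C) (Set.Iic 0) :=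
  isUnitAffineOn_of_eq (r := 0) hBC rfl fun _ hx => by rw [loop_of_nonpos hx, sub_zero]

lemma isUnitAffineOn_loop_fst (hAB : A ≠ B) :
    IsUnitAffineOn (loop A B C) (Set.Icc 0 (dist A B)) :=
  isUnitAffineOn_of_eq (r := 0) hAB rfl fun _ hx => by
    rw [loop_of_mem_fst hx.1 hx.2, sub_zero]

lemma isUnitAffineOn_loop_snd (hAB : A ≠ B) (hCA : C ≠ A) :
    IsUnitAffineOn (loop A B C) (Set.Icc (dist A B) (dist A B + dist C A)) :=
  isUnitAffineOn_of_eq hCA rfl fun _ hx => loop_of_mem_snd hAB hx.1 hx.2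

lemma isUnitAffineOn_loop_Ici (hAB : A ≠ B) (hBC : B ≠ C) (hCA : C ≠ A) :
    IsUnitAffineOn (loop A B C) (Set.Ici (dist A B + dist C A)) :=
  isUnitAffineOn_of_eq hBC rfl fun _ hx => by rw [loop_of_ge hAB hCA hx, sub_sub]

/-- The first and last pieces of `loop` are full rays, so the trajectories built from it keep unit
speed for all time, beyond the part that matters. -/
lemma hasUnitSpeedOn_loop (hAB : A ≠ B) (hBC : B ≠ C) (hCA : C ≠ A) :
    HasUnitSpeedOn (loop A B C) Set.univ := by
  have h1 := dist_pos.2 hAB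
  have h2 := dist_pos.2 hCA
  have e1 := (isUnitAffineOn_loop_Iic (A := A) hBC).hasUnitSpeedOn.union
    (isUnitAffineOn_loop_fst hAB).hasUnitSpeedOn isGreatest_Iic (isLeast_Icc h1.le)
  rw [Set.Iic_union_Icc_eq_Iic h1.le] at e1
  have e2 := e1.union (isUnitAffineOn_loop_snd hAB hCA).hasUnitSpeedOn isGreatest_Iic
    (isLeast_Icc (by linarith))
  rw [Set.Iic_union_Icc_eq_Iic (by linarith)] at e2
  have e3 := e2.union (isUnitAffineOn_loop_Ici hAB hBC hCA).hasUnitSpeedOn isGreatest_Iic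
    isLeast_Ici
  rwa [Set.Iic_union_Ici] at e3

lemma dist_loop_le (hAB : A ≠ B) (hBC : B ≠ C) (hCA : C ≠ A) {x y : ℝ} (hxy : x ≤ y) :
    dist (loop A B C x) (loop A B C y) ≤ y - x := by
  have h1 := hasUnitSpeedOn_loop hAB hBC hCA (Set.mem_univ x) (Set.mem_univ y)
  have h2 := eVariationOn.edist_le (loop A B C) (s := Set.univ ∩ Set.Icc x y) (x := x) (y := y)
    ⟨trivial, le_rfl, hxy⟩ ⟨trivial, hxy, le_rfl⟩
  rw [h1, edist_dist, ENNReal.ofReal_le_ofReal_iff (by simpa using hxy)] at h2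
  simpa using h2

lemma loop_neg (hBC : B ≠ C) : loop A B C (-dist B C) = C := by
  have := dist_pos.2 hBC
  rw [loop_of_nonpos (by linarith), neg_div, div_self this.ne']
  simp

lemma loop_zero : loop A B C 0 = B := by simp [loop]

lemma loop_fst (hAB : A ≠ B) : loop A B C (dist A B) = A := by
  have := dist_pos.2 hAB
  rw [loop_of_mem_fst this.le le_rfl, div_self this.ne']
  simp

lemma loop_snd (hAB : A ≠ B) (hCA : C ≠ A) : loop A B C (dist A B + dist C A) = C := by
  rw [loop_of_ge hAB hCA le_rfl]
  simp

lemma loop_add_period (hAB : A ≠ B) (hBC : B ≠ C) (hCA : C ≠ A) {x : ℝ} (h0 : -dist B C ≤ x)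
    (h1 : x ≤ 0) : loop A B C (dist A B + dist C A + dist B C + x) = loop A B C x := by
  have := dist_pos.2 hBC
  rw [loop_of_ge hAB hCA (by linarith), loop_of_nonpos h1, show dist A B + dist C A + dist B C + x
    - dist A B - dist C A = dist B C + x by ring, add_div, div_self this.ne']
  module

lemma loop_period (hAB : A ≠ B) (hBC : B ≠ C) (hCA : C ≠ A) :
    loop A B C (dist A B + dist C A + dist B C) = B := by
  have := loop_add_period hAB hBC hCA (x := 0) (by simp) le_rfl
  rwa [add_zero, loop_zero] at this

lemma exists_loop_neg_eq (hBC : B ≠ C) {X : Plane} (hX : X ∈ segment ℝ B C) :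
    ∃ v, 0 ≤ v ∧ v ≤ dist B C ∧ loop A B C (-v) = X := by
  have := dist_pos.2 hBC
  rw [segment_eq_image'] at hX
  obtain ⟨θ, ⟨h0, h1⟩, rfl⟩ := hX
  refine ⟨θ * dist B C, by positivity, by nlinarith, ?_⟩
  rw [loop_of_nonpos (by nlinarith), neg_div, mul_div_cancel_right₀ _ this.ne']
  module

lemma loop_neg_mem_segment (hBC : B ≠ C) {v : ℝ} (h0 : 0 ≤ v) (h1 : v ≤ dist B C) :
    loop A B C (-v) ∈ segment ℝ B C := by
  have := dist_pos.2 hBC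
  rw [segment_eq_image', loop_of_nonpos (by linarith)]
  refine ⟨v / dist B C, ⟨by positivity, (div_le_one this).2 h1⟩, ?_⟩
  dsimp only
  rw [neg_div]
  module

lemma mem_perimeter {X : Plane} : X ∈ perimeter A B C ↔
    X ∈ segment ℝ B C ∨ X ∈ segment ℝ C A ∨ X ∈ segment ℝ A B := by
  simp [perimeter, edge, Fin.exists_fin_succ]

lemma exists_loop_eq (hAB : A ≠ B) (hBC : B ≠ C) (hCA : C ≠ A) {X : Plane}
    (hX : X ∈ perimeter A B C) :
    ∃ x, -dist B C ≤ x ∧ x ≤ dist A B + dist C A ∧ loop A B C x = X := by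
  have ha := dist_pos.2 hBC
  have hb := dist_pos.2 hCA
  have hc := dist_pos.2 hAB
  rcases mem_perimeter.1 hX with h | h | h
  · obtain ⟨v, h0, h1, h2⟩ := exists_loop_neg_eq (A := A) hBC h
    exact ⟨-v, by linarith, by linarith, h2⟩
  · rw [segment_symm, segment_eq_image'] at h
    obtain ⟨θ, ⟨h0, h1⟩, rfl⟩ := h
    have : θ * dist C A ≤ dist C A := by nlinarith
    have : 0 ≤ θ * dist C A := by positivity
    refine ⟨dist A B + θ * dist C A, by linarith, by linarith, ?_⟩
    rw [loop_of_mem_snd hAB (by linarith) (by linarith), add_sub_cancel_left,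
      mul_div_cancel_right₀ _ hb.ne']
  · rw [segment_symm, segment_eq_image'] at h
    obtain ⟨θ, ⟨h0, h1⟩, rfl⟩ := h
    have : θ * dist A B ≤ dist A B := by nlinarith
    have : 0 ≤ θ * dist A B := by positivity
    refine ⟨θ * dist A B, by linarith, by linarith, ?_⟩
    rw [loop_of_mem_fst (by linarith) (by linarith), mul_div_cancel_right₀ _ hc.ne']

lemma loop_mem_convexHull (hAB : A ≠ B) (hBC : B ≠ C) (hCA : C ≠ A) {x : ℝ} (h0 : -dist B C ≤ x)
    (h1 : x ≤ dist A B + dist C A + dist B C) : loop A B C x ∈ convexHull ℝ {A, B, C} := by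
  have ha := dist_pos.2 hBC
  have hb := dist_pos.2 hCA
  have hc := dist_pos.2 hAB
  have key : ∀ X Y : Plane, X ∈ ({A, B, C} : Set Plane) → Y ∈ ({A, B, C} : Set Plane) →
      ∀ θ : ℝ, 0 ≤ θ → θ ≤ 1 → X + θ • (Y - X) ∈ convexHull ℝ {A, B, C} := by
    intro X Y hX hY θ h0 h1
    refine segment_subset_convexHull hX hY ?_
    rw [segment_eq_image']
    exact ⟨θ, ⟨h0, h1⟩, rfl⟩
  rcases le_total x 0 with h | h
  · obtain ⟨v, rfl⟩ : ∃ v, x = -v := ⟨-x, by ring⟩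
    refine segment_subset_convexHull (by simp) (by simp)
      (loop_neg_mem_segment (A := A) hBC (v := v) (by linarith) (by linarith))
  rcases le_total x (dist A B) with h2 | h2
  · rw [loop_of_mem_fst h h2]
    exact key B A (by simp) (by simp) _ (by positivity) ((div_le_one hc).2 h2)
  rcases le_total x (dist A B + dist C A) with h3 | h3
  · rw [loop_of_mem_snd hAB h2 h3]
    exact key A C (by simp) (by simp) _ (div_nonneg (by linarith) hb.le)
      ((div_le_one hb).2 (by linarith))
  · rw [loop_of_ge hAB hCA h3]
    exact key C B (by simp) (by simp) _ (div_nonneg (by linarith) ha.le)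
      ((div_le_one ha).2 (by linarith))

/-- The diameter of a convex hull is attained at its vertices. -/
lemma dist_loop_le_of_sides (hAB : A ≠ B) (hBC : B ≠ C) (hCA : C ≠ A) {m x y : ℝ}
    (hma : dist B C ≤ m) (hmb : dist C A ≤ m) (hmc : dist A B ≤ m) (hx : -dist B C ≤ x)
    (hx' : x ≤ dist A B + dist C A + dist B C) (hy : -dist B C ≤ y)
    (hy' : y ≤ dist A B + dist C A + dist B C) : dist (loop A B C x) (loop A B C y) ≤ m := by
  obtain ⟨X, hX, Y, hY, h⟩ := convexHull_exists_dist_ge2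
    (loop_mem_convexHull hAB hBC hCA hx hx') (loop_mem_convexHull hAB hBC hCA hy hy')
  refine h.trans ?_
  have h0 : 0 ≤ m := dist_nonneg.trans hma
  rcases hX with rfl | rfl | rfl <;> rcases hY with rfl | rfl | rfl <;>
    simp_all [dist_comm]

/-! ### Search in opposite directions. -/

lemma hasUnitSpeedOn_comp_add {γ : ℝ → Plane} (h : HasUnitSpeedOn γ Set.univ) (r : ℝ) :
    HasUnitSpeedOn (fun t => γ (t - r)) (Set.Ici 0) := by
  refine hasConstantSpeedOnWith_iff_ordered.2 fun x hx y hy hxy => ?_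
  have h1 := eVariationOn.comp_eq_of_monotoneOn γ (t := Set.Icc x y) (fun t => t - r)
    (fun s _ t _ hst => by simpa using hst)
  have h2 := h (Set.mem_univ (x - r)) (Set.mem_univ (y - r))
  have h3 : Set.Ici 0 ∩ Set.Icc x y = Set.Icc x y :=
    Set.inter_eq_right.2 fun t ht => le_trans (show (0 : ℝ) ≤ x from hx) ht.1
  rw [Set.univ_inter] at h2
  rw [Set.image_sub_const_Icc, h2] at h1
  rw [h3]
  refine h1.trans ?_
  congr 2
  ring

lemma hasUnitSpeedOn_comp_sub {γ : ℝ → Plane} (h : HasUnitSpeedOn γ Set.univ) (r : ℝ) :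
    HasUnitSpeedOn (fun t => γ (r - t)) (Set.Ici 0) := by
  refine hasConstantSpeedOnWith_iff_ordered.2 fun x hx y hy hxy => ?_
  have h1 := eVariationOn.comp_eq_of_antitoneOn γ (t := Set.Icc x y) (fun t => r - t)
    (fun s _ t _ hst => sub_le_sub_left hst r)
  have h2 := h (Set.mem_univ (r - y)) (Set.mem_univ (r - x))
  have h3 : Set.Ici 0 ∩ Set.Icc x y = Set.Icc x y :=
    Set.inter_eq_right.2 fun t ht => le_trans (show (0 : ℝ) ≤ x from hx) ht.1
  rw [Set.univ_inter] at h2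
  rw [Set.image_const_sub_Icc, h2] at h1
  rw [h3]
  refine h1.trans ?_
  congr 2
  ring

/-- The cost of the search in which the agents traverse the perimeter in opposite directions. -/
theorem optimalCost_le_of_opposite (hAB : A ≠ B) (hBC : B ≠ C) (hCA : C ≠ A) {v K : ℝ}
    (hv0 : 0 ≤ v) (hva : v ≤ dist B C)
    (h : ∀ t, 0 ≤ t → t ≤ (dist A B + dist C A + dist B C) / 2 →
      t + dist (loop A B C (t - v)) (loop A B C (dist A B + dist C A + dist B C - v - t)) ≤ K) :
    optimalCost A B C (loop A B C (-v)) ≤ ENNReal.ofReal K := by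
  have hγ := hasUnitSpeedOn_loop hAB hBC hCA
  have htri := dist_triangle B A C
  rw [dist_comm B A, dist_comm A C] at htri
  set r₁ : ℝ → Plane := fun t => loop A B C (t - v) with hr₁
  set r₂ : ℝ → Plane := fun t => loop A B C (dist A B + dist C A + dist B C - v - t) with hr₂
  have hvisit : ∀ X ∈ perimeter A B C, ∃ t ∈ visitTimes r₁ r₂ X,
      t ≤ (dist A B + dist C A + dist B C) / 2 := by
    intro X hX
    obtain ⟨x, h0, h1, rfl⟩ := exists_loop_eq hAB hBC hCA hX
    rcases le_total (x + v) 0 with h2 | h2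
    · refine ⟨-v - x, ⟨by linarith, Or.inr ?_⟩, by linarith⟩
      have := dist_pos.2 hBC
      have h3 := loop_add_period hAB hBC hCA h0 (by linarith : x ≤ 0)
      rw [← h3, hr₂]
      dsimp only
      congr 1
      ring
    · rcases le_total (x + v) ((dist A B + dist C A + dist B C) / 2) with h3 | h3
      · refine ⟨x + v, ⟨h2, Or.inl ?_⟩, h3⟩
        simp [hr₁]
      · refine ⟨dist A B + dist C A + dist B C - v - x, ⟨by linarith, Or.inr ?_⟩, by linarith⟩
        simp [hr₂]
  have hfeas : IsFeasible A B C (loop A B C (-v)) r₁ r₂ := by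
    refine ⟨by simp [hr₁], ?_, hasUnitSpeedOn_comp_add hγ v, hasUnitSpeedOn_comp_sub hγ _,
      fun X hX => ?_⟩
    · rw [← loop_add_period hAB hBC hCA (by linarith : -dist B C ≤ -v) (by linarith), hr₂]
      dsimp only
      congr 1
      ring
    · obtain ⟨t, ht, -⟩ := hvisit X hX
      exact ⟨t, ht⟩
  refine iInf_le_of_le r₁ (iInf_le_of_le r₂ (iInf_le_of_le hfeas (iSup₂_le fun X hX => ?_)))
  obtain ⟨t, ht⟩ := hfeas.exists_isLeast hX
  obtain ⟨s, hs, hs'⟩ := hvisit X hX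
  rw [evacuationTime_eq_of_isLeast ht]
  refine ENNReal.ofReal_le_ofReal (le_trans ?_ (h t ht.1.1 ((ht.2 hs).trans hs')))
  -- One of the agents is at `X`, so this maximum is the distance between the agents.
  have hmax : max (dist (r₁ t) X) (dist (r₂ t) X) ≤ dist (r₁ t) (r₂ t) := by
    rcases ht.1.2 with h1 | h1 <;> simp [h1, dist_comm]
  linarith

/-- While both agents move on straight lines their difference is affine in `t`, so `t` plus its norm
is convex and bounded by its values at the ends. -/
lemma IsUnitAffineOn.add_dist_le {γ : ℝ → Plane} {s s' : Set ℝ} [s.OrdConnected]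
    [s'.OrdConnected] (hs : IsUnitAffineOn γ s) (hs' : IsUnitAffineOn γ s')
    {t₀ t₁ t v w K : ℝ} (ht₀ : t₀ ≤ t) (ht₁ : t ≤ t₁) (hx₀ : t₀ - v ∈ s) (hx₁ : t₁ - v ∈ s)
    (hy₀ : w - t₀ ∈ s') (hy₁ : w - t₁ ∈ s') (h₀ : t₀ + dist (γ (t₀ - v)) (γ (w - t₀)) ≤ K)
    (h₁ : t₁ + dist (γ (t₁ - v)) (γ (w - t₁)) ≤ K) : t + dist (γ (t - v)) (γ (w - t)) ≤ K := by
  rcases ht₀.eq_or_lt with rfl | hlt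
  · exact h₀
  have hpos : 0 < t₁ - t₀ := by linarith
  obtain ⟨θ, hθ0, hθ1, rfl⟩ : ∃ θ : ℝ, 0 ≤ θ ∧ θ ≤ 1 ∧ t = (1 - θ) * t₀ + θ * t₁ := by
    refine ⟨(t - t₀) / (t₁ - t₀), div_nonneg (by linarith) hpos.le,
      (div_le_one hpos).2 (by linarith), ?_⟩
    field_simp
    ring
  have := hs.dist_le hs' hx₀ hx₁ hy₀ hy₁ hθ0 hθ1
  rw [show (1 - θ) * (t₀ - v) + θ * (t₁ - v) = (1 - θ) * t₀ + θ * t₁ - v by ring,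
    show (1 - θ) * (w - t₀) + θ * (w - t₁) = w - ((1 - θ) * t₀ + θ * t₁) by ring] at this
  nlinarith

/-- Convexity of the distance to a fixed point along a line. It is used with slopes `±1/2`: when one
agent reaches a corner, the position of the other moves by `2` per unit of `v`, so the dependence on
`v` cancels. -/
lemma IsUnitAffineOn.dist_le_affine {γ : ℝ → Plane} {s : Set ℝ} [s.OrdConnected]
    (hs : IsUnitAffineOn γ s) {X : Plane} {y₀ y₁ y m n : ℝ} (hy₀ : y₀ ≤ y) (hy₁ : y ≤ y₁)
    (hs₀ : y₀ ∈ s) (hs₁ : y₁ ∈ s) (h₀ : dist X (γ y₀) ≤ m * y₀ + n)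
    (h₁ : dist X (γ y₁) ≤ m * y₁ + n) : dist X (γ y) ≤ m * y + n := by
  rcases hy₀.eq_or_lt with rfl | hlt
  · exact h₀
  have hpos : 0 < y₁ - y₀ := by linarith
  obtain ⟨θ, hθ0, hθ1, rfl⟩ : ∃ θ : ℝ, 0 ≤ θ ∧ θ ≤ 1 ∧ y = (1 - θ) * y₀ + θ * y₁ := by
    refine ⟨(y - y₀) / (y₁ - y₀), div_nonneg (by linarith) hpos.le,
      (div_le_one hpos).2 (by linarith), ?_⟩
    field_simp
    ring
  obtain ⟨p, e, -, h⟩ := hs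
  have hmem : (1 - θ) * y₀ + θ * y₁ ∈ s :=
    Set.OrdConnected.convex ‹_› hs₀ hs₁ (by linarith) hθ0 (by ring)
  rw [h _ hs₀, dist_eq_norm] at h₀
  rw [h _ hs₁, dist_eq_norm] at h₁
  rw [h _ hmem, dist_eq_norm, show X - (p + ((1 - θ) * y₀ + θ * y₁) • e) =
    (1 - θ) • (X - (p + y₀ • e)) + θ • (X - (p + y₁ • e)) by module]
  refine (norm_add_le _ _).trans ?_
  rw [norm_smul, norm_smul, Real.norm_of_nonneg hθ0, Real.norm_of_nonneg (by linarith)]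
  nlinarith

/-- The agents, traversing the perimeter in opposite directions, never have a remaining distance
exceeding the unexplored part of the perimeter. -/
lemma add_dist_loop_le (hAB : A ≠ B) (hBC : B ≠ C) (hCA : C ≠ A) {v w t : ℝ}
    (h : t - v ≤ w - t) :
    t + dist (loop A B C (t - v)) (loop A B C (w - t)) ≤ w + v - t := by
  have := dist_loop_le hAB hBC hCA h
  linarith

/-! ### Upper bounds for starting points on a given edge. -/

lemma optimalCost_le_of_longest (hAB : A ≠ B) (hBC : B ≠ C) (hCA : C ≠ A) {m : ℝ}
    (hma : dist B C ≤ m) (hmb : dist C A ≤ m) (hmc : dist A B ≤ m) {S : Plane}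
    (hS : S ∈ segment ℝ B C) :
    optimalCost A B C S ≤ ENNReal.ofReal ((dist A B + dist C A + dist B C + m) / 2) := by
  obtain ⟨v, h0, h1, rfl⟩ := exists_loop_neg_eq (A := A) hBC hS
  have htri := dist_triangle B A C
  rw [dist_comm B A, dist_comm A C] at htri
  refine optimalCost_le_of_opposite hAB hBC hCA h0 h1 fun t ht0 ht1 => ?_
  -- At this time the unexplored length is exactly `m`: earlier the diameter bounds the distance
  -- between the agents, later the unexplored length does.
  rcases le_total t ((dist A B + dist C A + dist B C - m) / 2) with h | h
  · have := dist_loop_le_of_sides hAB hBC hCA hma hmb hmc (x := t - v)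
      (y := dist A B + dist C A + dist B C - v - t) (by linarith) (by linarith) (by linarith)
      (by linarith)
    linarith
  · have := add_dist_loop_le hAB hBC hCA (v := v) (t := t)
      (w := dist A B + dist C A + dist B C - v) (by linarith)
    linarith

/-- If the starting point is on the shortest edge, the cost is at most the sum of that edge and the
longest one. -/
lemma optimalCost_le_of_mem_shortest (hAB : A ≠ B) (hBC : B ≠ C) (hCA : C ≠ A)
    (hac : dist B C ≤ dist A B) (hcb : dist A B ≤ dist C A) {S : Plane}
    (hS : S ∈ segment ℝ B C) :
    optimalCost A B C S ≤ ENNReal.ofReal (dist B C + dist C A) := by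
  obtain ⟨v, h0, h1, rfl⟩ := exists_loop_neg_eq (A := A) hBC hS
  have htri := dist_triangle B A C
  rw [dist_comm B A, dist_comm A C] at htri
  have hdiam : ∀ t, 0 ≤ t → t ≤ (dist A B + dist C A + dist B C) / 2 → t ≤ dist B C →
      t + dist (loop A B C (t - v)) (loop A B C (dist A B + dist C A + dist B C - v - t)) ≤
        dist B C + dist C A := by
    intro t ht0 ht1 h
    have := dist_loop_le_of_sides hAB hBC hCA (hac.trans hcb) le_rfl hcb (x := t - v)
      (y := dist A B + dist C A + dist B C - v - t) (by linarith) (by linarith) (by linarith)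
      (by linarith)
    linarith
  have hrest : ∀ t, t ≤ (dist A B + dist C A + dist B C) / 2 → dist A B ≤ t →
      t + dist (loop A B C (t - v)) (loop A B C (dist A B + dist C A + dist B C - v - t)) ≤
        dist B C + dist C A := by
    intro t ht h
    have := add_dist_loop_le hAB hBC hCA (v := v) (t := t)
      (w := dist A B + dist C A + dist B C - v) (by linarith)
    linarith
  refine optimalCost_le_of_opposite hAB hBC hCA h0 h1 fun t ht0 ht1 => ?_
  rcases le_total t (dist B C) with h | h
  · exact hdiam t ht0 ht1 h
  rcases le_total (dist A B) t with h' | h'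
  · exact hrest t ht1 h'
  -- In this time interval both agents have left `BC`, so convexity bridges it.
  · refine (isUnitAffineOn_loop_fst hAB).add_dist_le (isUnitAffineOn_loop_snd hAB hCA)
      h h' ?_ ?_ ?_ ?_ (hdiam _ dist_nonneg (by linarith) le_rfl) (hrest _ (by linarith) le_rfl)
    all_goals constructor <;> linarith

/-- The search starting at the point of `BC` for which the agent going around `B` reaches `B` when
the other one, going around `C`, is at distance `p` from `A`. -/
lemma optimalCost_le_of_balanced (hAB : A ≠ B) (hBC : B ≠ C) (hCA : C ≠ A) {p K : ℝ}
    (hp : 0 ≤ p) (hpb : p ≤ dist C A) (hpc : p ≤ dist A B) (hpa : dist C A - dist B C ≤ p)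
    (hK : (dist B C + dist C A - p) / 2 + dist B (loop A B C (dist A B + p)) ≤ K)
    (hK' : (dist B C + dist C A - p) / 2 + dist A B ≤ K) :
    optimalCost A B C (loop A B C (-((dist B C + dist C A - p) / 2))) ≤ ENNReal.ofReal K := by
  have htri := dist_triangle B A C
  rw [dist_comm B A, dist_comm A C] at htri
  have hγ : ∀ {x y : ℝ}, x ≤ y → dist (loop A B C x) (loop A B C y) ≤ y - x :=
    fun h => dist_loop_le hAB hBC hCA h
  refine optimalCost_le_of_opposite hAB hBC hCA (by linarith) (by linarith) fun t ht0 ht1 => ?_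
  set a := dist B C
  set b := dist C A
  set c := dist A B
  set v := (a + b - p) / 2 with hv
  -- The breakpoints are `0`, `a - v` (corner `C`), `v` (corner `B`) and `v + p` (corner `A`). The
  -- first two cost no more than the third by the triangle inequality; the last two are `hK` and
  -- `hK'`.
  have g0 : (0 : ℝ) + dist (loop A B C (0 - v)) (loop A B C (c + b + a - v - 0)) ≤ K := by
    have := loop_add_period hAB hBC hCA (x := -v) (by change -a ≤ _; linarith) (by linarith)
    rw [sub_zero, zero_sub, sub_eq_add_neg, this, dist_self]
    linarith [dist_nonneg (x := A) (y := B)]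
  have gu : (a - v) + dist (loop A B C (a - v - v)) (loop A B C (c + b + a - v - (a - v))) ≤ K := by
    have e1 := hγ (show -v ≤ a - v - v by linarith)
    have e2 := hγ (show c + b + a - v - (a - v) ≤ c + b + a - v by linarith)
    have e3 := loop_add_period hAB hBC hCA (x := -v) (by change -a ≤ _; linarith) (by linarith)
    rw [← sub_eq_add_neg] at e3
    have e4 := dist_triangle (loop A B C (a - v - v)) (loop A B C (-v))
      (loop A B C (c + b + a - v - (a - v)))
    rw [dist_comm] at e1 e2
    have e5 : dist (loop A B C (-v)) (loop A B C (c + b + a - v - (a - v))) ≤ a - v := by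
      rw [← e3]; linarith
    have e6 := hγ (show c + p ≤ c + b by linarith)
    rw [loop_snd hAB hCA] at e6
    have e7 := dist_triangle B (loop A B C (c + p)) C
    have e8 : a = dist B C := rfl
    linarith
  have gv : v + dist (loop A B C (v - v)) (loop A B C (c + b + a - v - v)) ≤ K := by
    rw [sub_self, loop_zero, show c + b + a - v - v = c + p by rw [hv]; ring]
    exact hK
  have gw : v + p + dist (loop A B C (v + p - v)) (loop A B C (c + b + a - v - (v + p))) ≤ K := by
    have := hγ (show v + p - v ≤ c + b + a - v - (v + p) by linarith)
    linarith
  rcases le_total t (a - v) with h | h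
  · refine (isUnitAffineOn_loop_Iic hBC).add_dist_le (isUnitAffineOn_loop_Ici hAB hBC hCA)
      ht0 h ?_ ?_ ?_ ?_ g0 gu
    all_goals first | rw [Set.mem_Iic] | rw [Set.mem_Ici]
    all_goals linarith
  rcases le_total t v with h' | h'
  · refine (isUnitAffineOn_loop_Iic hBC).add_dist_le (isUnitAffineOn_loop_snd hAB hCA)
      h h' ?_ ?_ ?_ ?_ gu gv
    all_goals first | rw [Set.mem_Iic] | rw [Set.mem_Icc]
    all_goals first | linarith | (constructor <;> linarith)
  rcases le_total t (v + p) with h'' | h''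
  · refine (isUnitAffineOn_loop_fst hAB).add_dist_le (isUnitAffineOn_loop_snd hAB hCA)
      h' h'' ?_ ?_ ?_ ?_ gv gw
    all_goals constructor <;> linarith
  · have := add_dist_loop_le hAB hBC hCA (v := v) (t := t) (w := c + b + a - v) (by linarith)
    linarith

lemma dist_opposite_le (hAB : A ≠ B) (hBC : B ≠ C) (hCA : C ≠ A) {v t : ℝ} (hv0 : 0 ≤ v)
    (hva : v ≤ dist B C) (ht : 0 ≤ t) :
    dist (loop A B C (t - v)) (loop A B C (dist A B + dist C A + dist B C - v - t)) ≤ 2 * t := by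
  have e1 := dist_loop_le hAB hBC hCA (show -v ≤ t - v by linarith)
  have e2 := dist_loop_le hAB hBC hCA
    (show dist A B + dist C A + dist B C - v - t ≤ dist A B + dist C A + dist B C - v by linarith)
  have e3 := loop_add_period hAB hBC hCA (x := -v) (by linarith) (by linarith)
  rw [← sub_eq_add_neg] at e3
  rw [e3, dist_comm] at e2
  rw [dist_comm] at e1
  have := dist_triangle (loop A B C (t - v)) (loop A B C (-v))
    (loop A B C (dist A B + dist C A + dist B C - v - t))
  linarith

lemma optimalCost_le_of_mem_longest (hAB : A ≠ B) (hBC : B ≠ C) (hCA : C ≠ A)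
    (hcb : dist A B ≤ dist C A) (hba : dist C A ≤ (dist B C + dist A B) / 2)
    (hab : dist B C ≤ dist C A + dist A B / 2) {S : Plane} (hS : S ∈ segment ℝ B C) :
    optimalCost A B C S ≤ ENNReal.ofReal (dist B C / 2 + dist C A + dist A B / 2) := by
  obtain ⟨v, h0, h1, rfl⟩ := exists_loop_neg_eq (A := A) hBC hS
  have hc : 0 < dist A B := dist_pos.2 hAB
  have hb : 0 < dist C A := dist_pos.2 hCA
  have I0 := isUnitAffineOn_loop_Iic (A := A) hBC
  have I1 := isUnitAffineOn_loop_fst (C := C) hAB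
  have I2 := isUnitAffineOn_loop_snd hAB hCA
  have I3 := isUnitAffineOn_loop_Ici hAB hBC hCA
  have hA := loop_fst (C := C) hAB
  have hB := loop_zero (A := A) (B := B) (C := C)
  have hC := loop_snd hAB hCA
  have hC' := loop_neg (A := A) hBC
  have hP := loop_period hAB hBC hCA
  have hstart : ∀ t, 0 ≤ t → t ≤ dist B C / 2 →
      t + dist (loop A B C (t - v)) (loop A B C (dist A B + dist C A + dist B C - v - t)) ≤
        dist B C / 2 + dist C A + dist A B / 2 := by
    intro t ht ht'
    have := dist_opposite_le hAB hBC hCA h0 h1 ht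
    linarith
  have hend : ∀ t, t ≤ (dist A B + dist C A + dist B C) / 2 → (dist B C + dist A B) / 2 ≤ t →
      t + dist (loop A B C (t - v)) (loop A B C (dist A B + dist C A + dist B C - v - t)) ≤
        dist B C / 2 + dist C A + dist A B / 2 := by
    intro t ht h
    have := add_dist_loop_le hAB hBC hCA (v := v) (t := t)
      (w := dist A B + dist C A + dist B C - v) (by linarith)
    linarith
  have hend' := hend ((dist B C + dist A B) / 2) (by linarith) le_rfl
  refine optimalCost_le_of_opposite hAB hBC hCA h0 h1 fun t ht0 ht1 => ?_
  rcases le_total t (dist B C / 2) with hta | hta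
  · exact hstart t ht0 hta
  rcases le_total ((dist B C + dist A B) / 2) t with htb | htb
  · exact hend t ht1 htb
  generalize ha' : dist B C = a at *
  generalize hb' : dist C A = b at *
  generalize hc' : dist A B = c at *
  have hb'' := hb'
  have hc'' := hc'
  have ha'' := ha'
  rw [dist_comm] at hb'' hc'' ha''
  generalize loop A B C = γ at *
  -- The cases order the arrivals at corners: which of `C` (time `a - v`) and `B` (time `v`) is
  -- reached first, and whether the agent that was first reaches `A` before the other agent reaches
  -- its corner.
  rcases le_total (a - v) v with huv | huv
  · have gu := hstart (a - v) (by linarith) (by linarith)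
    rcases le_total v (a - v + b) with hw | hw
    · have gv : v + dist (γ (v - v)) (γ (c + b + a - v - v)) ≤ a / 2 + b + c / 2 := by
        have := I2.dist_le_affine (X := B) (y₀ := c) (y₁ := c + b) (y := c + b + a - v - v)
          (m := 1 / 2) (n := b / 2) (by linarith) (by linarith) ⟨by linarith, by linarith⟩
          ⟨by linarith, by linarith⟩ (by rw [hA]; linarith) (by rw [hC]; linarith)
        rw [sub_self, hB]
        linarith
      rcases le_total t v with htv | htv
      · refine I0.add_dist_le I2 (t₀ := a - v) (t₁ := v) (by linarith) htv ?_ ?_ ?_ ?_ gu gv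
        all_goals first | rw [Set.mem_Iic] | rw [Set.mem_Icc]
        all_goals first | linarith | (constructor <;> linarith)
      · refine I1.add_dist_le I2 htv htb ?_ ?_ ?_ ?_ gv hend'
        all_goals constructor <;> linarith
    · have gw : a - v + b + dist (γ (a - v + b - v)) (γ (c + b + a - v - (a - v + b))) ≤
          a / 2 + b + c / 2 := by
        have := I0.dist_le_affine (X := A) (y₀ := -a) (y₁ := 0) (y := a - v + b - v)
          (m := -1 / 2) (n := b / 2 + c / 2) (by linarith) (by linarith)
          (by rw [Set.mem_Iic]; linarith) (by rw [Set.mem_Iic]) (by rw [hC']; linarith)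
          (by rw [hB]; linarith)
        rw [show c + b + a - v - (a - v + b) = c by ring, hA, dist_comm]
        linarith
      rcases le_total t (a - v + b) with htv | htv
      · refine I0.add_dist_le I2 (t₀ := a - v) (by linarith) htv ?_ ?_ ?_ ?_ gu gw
        all_goals first | rw [Set.mem_Iic] | rw [Set.mem_Icc]
        all_goals first | linarith | (constructor <;> linarith)
      · refine I0.add_dist_le I1 htv htb ?_ ?_ ?_ ?_ gw hend'
        all_goals first | rw [Set.mem_Iic] | rw [Set.mem_Icc]
        all_goals first | linarith | (constructor <;> linarith)
  · have gv := hstart v (by linarith) (by linarith)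
    rcases le_total (a - v) (v + c) with hw | hw
    · have gu : a - v + dist (γ (a - v - v)) (γ (c + b + a - v - (a - v))) ≤
          a / 2 + b + c / 2 := by
        have := I1.dist_le_affine (X := C) (y₀ := 0) (y₁ := c) (y := a - v - v)
          (m := -1 / 2) (n := b + c / 2) (by linarith) (by linarith) ⟨by linarith, by linarith⟩
          ⟨by linarith, by linarith⟩ (by rw [hB]; linarith) (by rw [hA]; linarith)
        rw [show c + b + a - v - (a - v) = c + b by ring, hC, dist_comm]
        linarith
      rcases le_total t (a - v) with htv | htv
      · refine I1.add_dist_le I3 (t₀ := v) (by linarith) htv ?_ ?_ ?_ ?_ gv gu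
        all_goals first | rw [Set.mem_Ici] | rw [Set.mem_Icc]
        all_goals first | linarith | (constructor <;> linarith)
      · refine I1.add_dist_le I2 htv htb ?_ ?_ ?_ ?_ gu hend'
        all_goals constructor <;> linarith
    · have gw : v + c + dist (γ (v + c - v)) (γ (c + b + a - v - (v + c))) ≤
          a / 2 + b + c / 2 := by
        have := I3.dist_le_affine (X := A) (y₀ := c + b) (y₁ := c + b + a)
          (y := c + b + a - v - (v + c)) (m := 1 / 2) (n := b / 2 - c / 2) (by linarith)
          (by linarith) (by rw [Set.mem_Ici]) (by rw [Set.mem_Ici]; linarith)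
          (by rw [hC]; linarith) (by rw [hP]; linarith)
        rw [add_sub_cancel_left, hA]
        linarith
      rcases le_total t (v + c) with htv | htv
      · refine I1.add_dist_le I3 (t₀ := v) (by linarith) htv ?_ ?_ ?_ ?_ gv gw
        all_goals first | rw [Set.mem_Ici] | rw [Set.mem_Icc]
        all_goals first | linarith | (constructor <;> linarith)
      · refine I2.add_dist_le I3 htv htb ?_ ?_ ?_ ?_ gw hend'
        all_goals first | rw [Set.mem_Ici] | rw [Set.mem_Icc]
        all_goals first | linarith | (constructor <;> linarith)

/-! ### Balanced searches and the 60° point. -/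

/-- Stewart's theorem. -/
lemma dist_add_smul_sub_sq (X Y Z : Plane) (θ : ℝ) :
    dist X (Y + θ • (Z - Y)) ^ 2 =
      (1 - θ) * dist X Y ^ 2 + θ * dist X Z ^ 2 - θ * (1 - θ) * dist Y Z ^ 2 := by
  have e1 : X - (Y + θ • (Z - Y)) = (X - Y) - θ • (Z - Y) := by module
  have e2 : X - Z = (X - Y) - (Z - Y) := by abel
  rw [dist_comm Y Z, dist_eq_norm, dist_eq_norm, dist_eq_norm, dist_eq_norm, e1, e2,
    norm_sub_sq_real (X - Y) (θ • (Z - Y)), norm_sub_sq_real (X - Y) (Z - Y), norm_smul, inner_smul_right, mul_pow, Real.norm_eq_abs,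
    sq_abs]
  ring

lemma dist_loop_snd_sq (hAB : A ≠ B) (hCA : C ≠ A) {p : ℝ} (h0 : 0 ≤ p) (h1 : p ≤ dist C A) :
    dist B (loop A B C (dist A B + p)) ^ 2 = dist A B ^ 2 -
      p / dist C A * (dist C A ^ 2 + dist A B ^ 2 - dist B C ^ 2) + p ^ 2 := by
  have := dist_pos.2 hCA
  rw [loop_of_mem_snd hAB (by linarith) (by linarith), dist_add_smul_sub_sq, add_sub_cancel_left,
    dist_comm B A, dist_comm A C]
  field_simp
  ring

/-- If the angle at `A` is at most `60°`, the balanced search takes half the perimeter. -/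
lemma exists_optimalCost_le_half_perimeter (hAB : A ≠ B) (hBC : B ≠ C) (hCA : C ≠ A)
    (hcb : dist A B ≤ dist C A)
    (hA : dist C A * dist A B ≤ dist C A ^ 2 + dist A B ^ 2 - dist B C ^ 2) :
    ∃ S ∈ segment ℝ B C, optimalCost A B C S ≤
      ENNReal.ofReal ((dist B C + dist C A + dist A B) / 2) := by
  have htri := dist_triangle C B A
  have htri' := dist_triangle B A C
  rw [dist_comm B A, dist_comm A C] at htri'
  rw [dist_comm C B, dist_comm B A] at htri
  have hb := dist_pos.2 hCA
  have hc := dist_pos.2 hAB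
  refine ⟨_, loop_neg_mem_segment hBC ?_ ?_, optimalCost_le_of_balanced hAB hBC hCA
    (p := dist A B) hc.le hcb le_rfl (by linarith) ?_ (by linarith)⟩
  · linarith
  · linarith
  -- With `p = AB` the two critical points form with `A` an isosceles triangle with legs `AB` and
  -- apex angle at most 60°, so its base is at most `AB`.
  have h1 := dist_loop_snd_sq hAB hCA hc.le hcb
  have h2 : dist A B / dist C A * (dist C A * dist A B) ≤ dist A B / dist C A *
    (dist C A ^ 2 + dist A B ^ 2 - dist B C ^ 2) := by gcongr
  have h3 : dist A B / dist C A * (dist C A * dist A B) = dist A B ^ 2 := by field_simp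
  have h4 : dist B (loop A B C (dist A B + dist A B)) ≤ dist A B :=
    abs_le_of_sq_le_sq' (by linarith) hc.le |>.2
  linarith

/-- The position of the point on the edge `b` from which the edge `c` is seen at an angle of
`60°`: its distance `p` to the common vertex of the two edges, and its distance `d` to the other
endpoint of `c`. -/
lemma exists_sixty_degree_point {a b c τ : ℝ} (ha : 0 < a) (hb : 0 < b) (hc : 0 < c)
    (htri : b - a ≤ c) (htri' : a - b ≤ c) (hA : b ^ 2 + c ^ 2 - a ^ 2 ≤ b * c)
    (hA' : 0 ≤ b ^ 2 + c ^ 2 - a ^ 2) (hC : a * b ≤ a ^ 2 + b ^ 2 - c ^ 2) (hτ0 : 0 ≤ τ)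
    (hτ : 16 * τ ^ 2 = 4 * b ^ 2 * c ^ 2 - (b ^ 2 + c ^ 2 - a ^ 2) ^ 2) :
    ∃ p d, 0 ≤ p ∧ p ≤ b ∧ p ≤ c ∧ b - a ≤ p ∧ c ≤ d ∧
      c ^ 2 - p / b * (b ^ 2 + c ^ 2 - a ^ 2) + p ^ 2 = d ^ 2 ∧
      ((a + b) ^ 2 - c ^ 2 + 4 * Real.sqrt 3 * τ) / (4 * b) = (a + b - p) / 2 + d := by
  -- `k` is the distance from the common vertex to the foot of the altitude on the edge `b`, and `h`
  -- is that altitude over `√3`. The 60° point lies `h` beyond the foot, so `p = k + h` and `d = 2 *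
  -- h`.
  obtain ⟨k, hk⟩ : ∃ k, k = (b ^ 2 + c ^ 2 - a ^ 2) / (2 * b) := ⟨_, rfl⟩
  obtain ⟨h, hh⟩ : ∃ h, h = 2 * τ / b / Real.sqrt 3 := ⟨_, rfl⟩
  have s3 : Real.sqrt 3 ^ 2 = 3 := Real.sq_sqrt (by norm_num)
  have s3' : 0 < Real.sqrt 3 := by positivity
  have hh0 : 0 ≤ h := by rw [hh]; positivity
  have hk' : b ^ 2 + c ^ 2 - a ^ 2 = 2 * b * k := by
    rw [hk]; field_simp
  have hh' : 3 * h ^ 2 + k ^ 2 = c ^ 2 := by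
    have : 3 * h ^ 2 = 16 * τ ^ 2 / (4 * b ^ 2) := by
      rw [hh, div_pow, s3]; field_simp; ring
    rw [this, hτ, hk']
    field_simp
    ring
  have hk0 : 0 ≤ k := by rw [hk]; positivity
  have hkc : 2 * k ≤ c := by
    rw [hk'] at hA
    exact le_of_mul_le_mul_left (by linarith) hb
  have hpc : k + h ≤ c := by
    have : h ≤ c - k := abs_le_of_sq_le_sq' (by nlinarith) (by linarith) |>.2
    linarith
  have hba : b - a ≤ k := by
    have h1 : (b - a) ^ 2 ≤ c ^ 2 := sq_le_sq' (by linarith) htri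
    exact le_of_mul_le_mul_left (a := 2 * b) (by rw [← hk']; linarith) (by positivity)
  have hac : a ≤ 2 * (b - k) := le_of_mul_le_mul_left (a := b) (by linarith) hb
  have hpb : k + h ≤ b := by
    have h1 : a ^ 2 ≤ (2 * (b - k)) ^ 2 := pow_le_pow_left₀ ha.le hac 2
    have : h ≤ b - k := abs_le_of_sq_le_sq' (by linarith) (by linarith) |>.2
    linarith
  refine ⟨k + h, 2 * h, by linarith, hpb, hpc, by linarith,
    abs_le_of_sq_le_sq' (by nlinarith) (by linarith) |>.2, ?_, ?_⟩
  · rw [hk', show (k + h) / b * (2 * b * k) = 2 * (k + h) * k by field_simp]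
    linarith
  · have h3 : Real.sqrt 3 * τ = 3 / 2 * b * h := by
      rw [hh]
      field_simp
      linear_combination τ * s3
    rw [div_eq_iff (by positivity)]
    linear_combination 4 * h3 - hk'

/-- The balanced search with angle `60°` at the critical point; the angle at `A` is between `60°`
and `90°`, the angle at `C` is at most `60°`. -/
lemma exists_optimalCost_le_area (hAB : A ≠ B) (hBC : B ≠ C) (hCA : C ≠ A)
    (hA : dist C A ^ 2 + dist A B ^ 2 - dist B C ^ 2 ≤ dist C A * dist A B)
    (hA' : 0 ≤ dist C A ^ 2 + dist A B ^ 2 - dist B C ^ 2)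
    (hC : dist B C * dist C A ≤ dist B C ^ 2 + dist C A ^ 2 - dist A B ^ 2) {τ : ℝ} (hτ0 : 0 ≤ τ)
    (hτ : 16 * τ ^ 2 = 4 * dist C A ^ 2 * dist A B ^ 2 -
      (dist C A ^ 2 + dist A B ^ 2 - dist B C ^ 2) ^ 2) :
    ∃ S ∈ segment ℝ B C, optimalCost A B C S ≤
      ENNReal.ofReal (((dist B C + dist C A) ^ 2 - dist A B ^ 2 + 4 * Real.sqrt 3 * τ) /
        (4 * dist C A)) := by
  have htri := dist_triangle C B A
  have htri' := dist_triangle B A C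
  rw [dist_comm B A, dist_comm A C] at htri'
  rw [dist_comm C B, dist_comm B A] at htri
  obtain ⟨p, d, hp0, hpb, hpc, hpa, hcd, hd, htarget⟩ := exists_sixty_degree_point
    (dist_pos.2 hBC) (dist_pos.2 hCA) (dist_pos.2 hAB) (by linarith) (by linarith) hA hA' hC hτ0 hτ
  have hdist : dist B (loop A B C (dist A B + p)) = d :=
    (sq_eq_sq₀ dist_nonneg (dist_nonneg.trans hcd)).1
      ((dist_loop_snd_sq hAB hCA hp0 hpb).trans hd)
  rw [htarget]
  exact ⟨_, loop_neg_mem_segment hBC (by linarith) (by linarith),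
    optimalCost_le_of_balanced hAB hBC hCA hp0 hpb hpc hpa (by rw [hdist]) (by linarith)⟩

/-! ### Area. -/

open MeasureTheory in
lemma volume_standard_triangle :
    volume {x : Fin 2 → ℝ | 0 ≤ x 0 ∧ 0 ≤ x 1 ∧ x 0 + x 1 ≤ 1} = ENNReal.ofReal (1 / 2) := by
  have hmeas : MeasurableSet {x : ℝ × ℝ | 0 ≤ x.1 ∧ 0 ≤ x.2 ∧ x.1 + x.2 ≤ 1} := by
    refine IsClosed.measurableSet ?_
    exact (isClosed_le continuous_const continuous_fst).inter
      ((isClosed_le continuous_const continuous_snd).inter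
        (isClosed_le (continuous_fst.add continuous_snd) continuous_const))
  have h1 := (volume_preserving_finTwoArrow ℝ).measure_preimage hmeas.nullMeasurableSet
  have h2 : (MeasurableEquiv.finTwoArrow (α := ℝ)) ⁻¹'
      {x : ℝ × ℝ | 0 ≤ x.1 ∧ 0 ≤ x.2 ∧ x.1 + x.2 ≤ 1} =
      {x : Fin 2 → ℝ | 0 ≤ x 0 ∧ 0 ≤ x 1 ∧ x 0 + x 1 ≤ 1} := rfl
  rw [← h2, h1, Measure.volume_eq_prod, Measure.prod_apply hmeas]
  have h3 : ∀ x : ℝ, volume (Prod.mk x ⁻¹' {x : ℝ × ℝ | 0 ≤ x.1 ∧ 0 ≤ x.2 ∧ x.1 + x.2 ≤ 1}) =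
      (Set.Icc (0 : ℝ) 1).indicator (fun x => ENNReal.ofReal (1 - x)) x := by
    intro x
    by_cases hx : 0 ≤ x
    · have : Prod.mk x ⁻¹' {x : ℝ × ℝ | 0 ≤ x.1 ∧ 0 ≤ x.2 ∧ x.1 + x.2 ≤ 1} =
          Set.Icc 0 (1 - x) := by
        ext y
        simp only [Set.mem_preimage, Set.mem_ofPred_eq, Set.mem_Icc, hx, true_and,
          le_sub_iff_add_le']
      rw [this, Real.volume_Icc, sub_zero]
      by_cases hx1 : x ≤ 1
      · rw [Set.indicator_of_mem (show x ∈ Set.Icc (0 : ℝ) 1 from ⟨hx, hx1⟩)]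
      · rw [Set.indicator_of_notMem fun h => hx1 h.2, ENNReal.ofReal_of_nonpos (by linarith)]
    · rw [Set.indicator_of_notMem fun h => hx h.1]
      convert measure_empty (μ := (volume : Measure ℝ))
      ext y
      simp [hx]
  simp_rw [h3]
  rw [lintegral_indicator measurableSet_Icc, ← ofReal_integral_eq_lintegral_ofReal,
    integral_Icc_eq_integral_Ioc, ← intervalIntegral.integral_of_le zero_le_one]
  · congr 1
    rw [intervalIntegral.integral_sub (by simp) (by simp)]
    simp
    norm_num
  · exact (by fun_prop : Continuous fun x : ℝ => 1 - x).continuousOn.integrableOn_Icc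
  · filter_upwards [ae_restrict_mem measurableSet_Icc] with x hx
    simpa using hx.2

open MeasureTheory in
/-- Heron's formula for the area, as a lower bound. -/
lemma exists_le_area (A B C : Plane) : ∃ τ, 0 ≤ τ ∧ τ ≤ area A B C ∧
    16 * τ ^ 2 = 4 * dist C A ^ 2 * dist A B ^ 2 -
      (dist C A ^ 2 + dist A B ^ 2 - dist B C ^ 2) ^ 2 := by
  let M : Matrix (Fin 2) (Fin 2) ℝ := !![B 0 - A 0, C 0 - A 0; B 1 - A 1, C 1 - A 1]
  have hdet : M.det = (B 0 - A 0) * (C 1 - A 1) - (C 0 - A 0) * (B 1 - A 1) := by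
    simp [M, Matrix.det_fin_two]
  refine ⟨|M.det| / 2, by positivity, ?_, ?_⟩
  -- Only one inclusion is needed: the affine image of the standard triangle lies in the solid
  -- triangle.
  · have hsub : (fun y => y + A.ofLp) '' (Matrix.toLin' M ''
        {x : Fin 2 → ℝ | 0 ≤ x 0 ∧ 0 ≤ x 1 ∧ x 0 + x 1 ≤ 1}) ⊆
        (WithLp.toLp 2 : (Fin 2 → ℝ) → Plane) ⁻¹' convexHull ℝ {A, B, C} := by
      rintro _ ⟨_, ⟨x, ⟨h0, h1, h2⟩, rfl⟩, rfl⟩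
      have h3 : WithLp.toLp 2 (Matrix.toLin' M x + A.ofLp) =
          (1 - x 0 - x 1) • A + x 0 • B + x 1 • C := by
        ext i
        fin_cases i <;>
          simp [M, dotProduct, Fin.sum_univ_two] <;> ring
      rw [Set.mem_preimage, h3]
      have := (convex_convexHull ℝ ({A, B, C} : Set Plane)).sum_mem (t := Finset.univ)
        (w := ![1 - x 0 - x 1, x 0, x 1]) (z := ![A, B, C])
        (by intro i _; fin_cases i <;> simp <;> linarith)
        (by simp [Fin.sum_univ_three]; ring)
        (by intro i _; fin_cases i <;> exact subset_convexHull ℝ _ (by simp))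
      simpa [Fin.sum_univ_three] using this
    have hconv : MeasurableSet (convexHull ℝ {A, B, C} : Set Plane) :=
      ((Set.toFinite {A, B, C}).isCompact_convexHull ℝ).isClosed.measurableSet
    have h1 := measure_mono (μ := volume) hsub
    rw [(PiLp.volume_preserving_toLp (Fin 2)).measure_preimage hconv.nullMeasurableSet,
      Set.image_add_right, measure_preimage_add_right, Measure.addHaar_image_linearMap,
      LinearMap.det_toLin', volume_standard_triangle, ← ENNReal.ofReal_mul (abs_nonneg _)] at h1
    have hfin : volume (convexHull ℝ {A, B, C} : Set Plane) ≠ ⊤ :=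
      ((Set.toFinite {A, B, C}).isCompact_convexHull ℝ).measure_lt_top.ne
    rw [ENNReal.ofReal_le_iff_le_toReal hfin] at h1
    rw [area]
    linarith
  · have hd : ∀ X Y : Plane, dist X Y ^ 2 = (X 0 - Y 0) ^ 2 + (X 1 - Y 1) ^ 2 := fun X Y => by
      rw [EuclideanSpace.dist_eq, Real.sq_sqrt (by positivity), Fin.sum_univ_two, Real.dist_eq,
        Real.dist_eq, sq_abs, sq_abs]
    rw [hd, hd, hd, div_pow, sq_abs, hdet]
    ring

/-! ### Relabelling the vertices, special starting points, comparison of bounds. -/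

/-- The cost sees the triangle only through its perimeter, so the bounds for starts on `BC` transfer
to every edge. -/
lemma optimalCost_congr {A' B' C' : Plane} (h : perimeter A B C = perimeter A' B' C')
    (S : Plane) : optimalCost A B C S = optimalCost A' B' C' S := by
  have h1 : ∀ r₁ r₂, IsFeasible A B C S r₁ r₂ ↔ IsFeasible A' B' C' S r₁ r₂ := fun r₁ r₂ =>
    ⟨fun ⟨a, b, c, d, e⟩ => ⟨a, b, c, d, h ▸ e⟩, fun ⟨a, b, c, d, e⟩ => ⟨a, b, c, d, h ▸ e⟩⟩
  simp only [optimalCost, evacuationCost, h1, h]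

lemma optimalCost_rotate (S : Plane) : optimalCost A B C S = optimalCost B C A S :=
  optimalCost_congr (by ext; rw [mem_perimeter, mem_perimeter]; tauto) S

lemma optimalCost_swap (S : Plane) : optimalCost A B C S = optimalCost A C B S :=
  optimalCost_congr (by
    ext
    rw [mem_perimeter, mem_perimeter, segment_symm ℝ C B, segment_symm ℝ B A, segment_symm ℝ A C]
    tauto) S

/-- The search starting at a vertex. -/
lemma optimalCost_vertex_le (hAB : A ≠ B) (hBC : B ≠ C) (hCA : C ≠ A)
    (hab : dist B C ≤ dist C A) :
    optimalCost A B C C ≤ ENNReal.ofReal (dist B C + dist A B) := by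
  have htri := dist_triangle C B A
  rw [dist_comm C B, dist_comm B A] at htri
  have ha := dist_pos.2 hBC
  have hb := dist_pos.2 hCA
  have hc := dist_pos.2 hAB
  -- The balanced search with `p = CA - BC` is the one that starts at `C` itself.
  have hp : 0 ≤ dist C A - dist B C := by linarith
  have hv : (dist B C + dist C A - (dist C A - dist B C)) / 2 = dist B C := by ring
  have h1 := dist_loop_snd_sq (B := B) hAB hCA hp (by linarith)
  have h2 : dist B (loop A B C (dist A B + (dist C A - dist B C))) ≤ dist A B := by
    refine abs_le_of_sq_le_sq' ?_ hc.le |>.2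
    rw [h1]
    have h3 : (dist C A - dist B C) / dist C A * (dist C A * (dist C A - dist B C)) ≤
        (dist C A - dist B C) / dist C A * (dist C A ^ 2 + dist A B ^ 2 - dist B C ^ 2) := by
      gcongr
      nlinarith
    have h4 : (dist C A - dist B C) / dist C A * (dist C A * (dist C A - dist B C)) =
        (dist C A - dist B C) ^ 2 := by field_simp
    linarith
  have := optimalCost_le_of_balanced hAB hBC hCA hp (by linarith) (by linarith) le_rfl
    (K := dist B C + dist A B) (by rw [hv]; linarith) (by rw [hv])
  rwa [hv, loop_neg hBC] at this

/-- `S` is the point of `YZ` for which the ways `S → Y → X` and `S → Z` are equally long; hence `SX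
≤ SZ`, and Stewart's theorem evaluates `SX`. -/
lemma exists_mem_segment_dist_eq {X Y Z : Plane} (hYZ : Y ≠ Z) (h : dist X Y ≤ dist Y Z) :
    ∃ S ∈ segment ℝ Y Z, dist S X = 1 / 2 * Real.sqrt ((2 * dist X Z ^ 2 * (dist Y Z - dist X Y) -
      (dist Y Z - 2 * dist X Y) * (dist Y Z + dist X Y) ^ 2) / dist Y Z) ∧
      dist S X ≤ dist S Z := by
  have hp := dist_pos.2 hYZ
  have hq : 0 ≤ dist X Y := dist_nonneg
  obtain ⟨θ, hθ⟩ : ∃ θ, θ = (dist Y Z - dist X Y) / (2 * dist Y Z) := ⟨_, rfl⟩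
  have hθ0 : 0 ≤ θ := by rw [hθ]; exact div_nonneg (by linarith) (by linarith)
  have hθ1 : θ ≤ 1 := by rw [hθ, div_le_one (by linarith)]; linarith
  have hθp : θ * dist Y Z = (dist Y Z - dist X Y) / 2 := by rw [hθ]; field_simp
  have hY : dist (Y + θ • (Z - Y)) Y = (dist Y Z - dist X Y) / 2 := by
    rw [dist_eq_norm, add_sub_cancel_left, norm_smul, Real.norm_of_nonneg hθ0, ← dist_eq_norm,
      dist_comm Z Y, hθp]
  have hZ : dist (Y + θ • (Z - Y)) Z = (dist Y Z + dist X Y) / 2 := by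
    rw [dist_eq_norm, show Y + θ • (Z - Y) - Z = (1 - θ) • (Y - Z) by module, norm_smul,
      Real.norm_of_nonneg (by linarith), ← dist_eq_norm]
    linarith
  refine ⟨Y + θ • (Z - Y), ?_, ?_, ?_⟩
  · rw [segment_eq_image']
    exact ⟨θ, ⟨hθ0, hθ1⟩, rfl⟩
  · have h1 := dist_add_smul_sub_sq X Y Z θ
    have h2 : (2 * dist X Z ^ 2 * (dist Y Z - dist X Y) -
        (dist Y Z - 2 * dist X Y) * (dist Y Z + dist X Y) ^ 2) / dist Y Z =
        (2 * dist X (Y + θ • (Z - Y))) ^ 2 := by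
      rw [mul_pow, h1, hθ]
      field_simp
      ring
    rw [h2, Real.sqrt_sq (by positivity), dist_comm]
    ring
  · have := dist_triangle (Y + θ • (Z - Y)) Y X
    rw [dist_comm Y X] at this
    linarith

lemma half_perimeter_le_area_bound {a b c τ : ℝ} (ha : 0 < a) (hb : 0 < b) (hc : 0 < c)
    (hab : b ≤ a) (hbc : c ≤ b) (htri : a ≤ b + c) (hτ0 : 0 ≤ τ)
    (hτ : 16 * τ ^ 2 = 4 * b ^ 2 * c ^ 2 - (b ^ 2 + c ^ 2 - a ^ 2) ^ 2) :
    (a + b + c) / 2 ≤ ((a + b) ^ 2 - c ^ 2 + 4 * Real.sqrt 3 * τ) / (4 * b) := by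
  have s3 : Real.sqrt 3 ^ 2 = 3 := Real.sq_sqrt (by norm_num)
  have hA : b ^ 2 + c ^ 2 - b * c ≤ a ^ 2 := by nlinarith
  -- After squaring and inserting Heron's formula, this says that the angle opposite `a` is at least
  -- 60°, which is `hA`.
  have h1 : (a + b + c) * (b + c - a) ≤ 4 * Real.sqrt 3 * τ := by
    refine abs_le_of_sq_le_sq' ?_ (by positivity) |>.2
    have h2 : 0 ≤ ((a + b + c) * (b + c - a)) * (4 * (a ^ 2 - (b ^ 2 + c ^ 2 - b * c))) :=
      mul_nonneg (mul_nonneg (by linarith) (by linarith)) (by linarith)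
    linear_combination h2 - 3 * hτ - 16 * τ ^ 2 * s3
  rw [div_le_div_iff₀ (by norm_num) (by positivity)]
  linarith

end TriangleEvacuation

/-! ### The theorem. -/

open TriangleEvacuation
theorem theorem1 (A B C : TriangleEvacuation.Plane)
    (hABC : AffineIndependent ℝ ![A, B, C])
    (hA : EuclideanGeometry.angle B A C ≤ Real.pi / 2)
    (hB : EuclideanGeometry.angle A B C ≤ Real.pi / 2)
    (hC : EuclideanGeometry.angle A C B ≤ Real.pi / 2)
    (a b c τ : ℝ)
    (ha : a = dist B C) (hb : b = dist C A) (hc : c = dist A B)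
    (hτ : τ = TriangleEvacuation.area A B C)
    (hab : b ≤ a) (hbc : c ≤ b) :
    TriangleEvacuation.lowerL A B C = ENNReal.ofReal ((a + b + c) / 2) ∧
    (ENNReal.ofReal ((a + b + c) / 2) ≤ TriangleEvacuation.upperL A B C ∧
      TriangleEvacuation.upperL A B C ≤
        ENNReal.ofReal (min (b + c)
          (((a + b) ^ 2 - c ^ 2 + 4 * Real.sqrt 3 * τ) / (4 * b)))) ∧
    (ENNReal.ofReal (min
        (1 / 2 * Real.sqrt ((2 * b ^ 2 * (a - c) - (a - 2 * c) * (a + c) ^ 2) / a) + b)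
        (a + c)) ≤ TriangleEvacuation.lowerU A B C ∧
      TriangleEvacuation.lowerU A B C ≤ ENNReal.ofReal (min (a / 2 + b + c / 2) (a + c))) ∧
    (ENNReal.ofReal
        (a + 1 / 2 * Real.sqrt ((2 * a ^ 2 * (b - c) - (b - 2 * c) * (b + c) ^ 2) / b)) ≤
        TriangleEvacuation.upperU A B C ∧
      TriangleEvacuation.upperU A B C ≤ ENNReal.ofReal (a + (b + c) / 2)) := by
  have hinj := hABC.injective
  have hAB : A ≠ B := fun h => absurd (hinj (a₁ := 0) (a₂ := 1) (by simpa using h)) (by decide)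
  have hBC : B ≠ C := fun h => absurd (hinj (a₁ := 1) (a₂ := 2) (by simpa using h)) (by decide)
  have hCA : C ≠ A := fun h => absurd (hinj (a₁ := 2) (a₂ := 0) (by simpa using h)) (by decide)
  have ha0 : 0 < a := ha ▸ dist_pos.2 hBC
  have hb0 : 0 < b := hb ▸ dist_pos.2 hCA
  have hc0 : 0 < c := hc ▸ dist_pos.2 hAB
  have htri : a ≤ b + c := by
    have := dist_triangle B A C
    rw [dist_comm B A, dist_comm A C] at this
    linarith
  have ha' : a = dist C B := by rw [dist_comm]; exact ha
  have hb' : b = dist A C := by rw [dist_comm]; exact hb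
  have hc' : c = dist B A := by rw [dist_comm]; exact hc
  have hobt : 0 ≤ b ^ 2 + c ^ 2 - a ^ 2 := by
    have h1 := EuclideanGeometry.law_cos B A C
    rw [← ha, ← hb, ← hc'] at h1
    have h2 : 0 ≤ Real.cos (EuclideanGeometry.angle B A C) :=
      Real.cos_nonneg_of_neg_pi_div_two_le_of_le
        (by linarith [EuclideanGeometry.angle_nonneg B A C, Real.pi_pos]) hA
    nlinarith [mul_nonneg (mul_nonneg hc0.le hb0.le) h2]
  -- The area enters only an upper bound that increases with it, so a lower estimate `τ₀` is enough.
  obtain ⟨τ₀, hτ0, hτ₀, hheron⟩ := exists_le_area A B C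
  rw [← ha, ← hb, ← hc] at hheron
  rw [← hτ] at hτ₀
  have hAmem : A ∈ perimeter A B C := mem_perimeter.2 (Or.inr (Or.inl (right_mem_segment ℝ C A)))
  have hBmem : B ∈ perimeter A B C := mem_perimeter.2 (Or.inl (left_mem_segment ℝ B C))
  have hCmem : C ∈ perimeter A B C := mem_perimeter.2 (Or.inl (right_mem_segment ℝ B C))
  have hmin : ∀ x y : ℝ, ENNReal.ofReal (min x y) = min (ENNReal.ofReal x) (ENNReal.ofReal y) :=
    fun x y => ENNReal.ofReal_mono.map_min
  have hhalf : ∀ S, ENNReal.ofReal ((a + b + c) / 2) ≤ optimalCost A B C S := fun S => by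
    rw [ha, hb, hc]; exact half_perimeter_le_optimalCost hABC S
  have hrot : ∀ S, optimalCost C A B S = optimalCost A B C S := fun S => optimalCost_rotate S
  have hrot' : ∀ S, optimalCost B C A S = optimalCost A B C S := fun S =>
    (optimalCost_rotate S).symm
  have hswap : ∀ S, optimalCost B A C S = optimalCost A B C S := fun S => by
    rw [optimalCost_rotate, optimalCost_swap]
  -- Start on the shortest edge `AB`; the opposite angle, at `C`, is at most 60°.
  obtain ⟨S₂, hS₂, hS₂'⟩ := exists_optimalCost_le_half_perimeter hCA hAB hBC
    (by rw [← ha, ← hb]; exact hab) (by rw [← ha, ← hb, ← hc]; nlinarith)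
  rw [← ha, ← hb, ← hc, hrot, show c + a + b = a + b + c by ring] at hS₂'
  have hvertexA : ENNReal.ofReal (a + c) ≤ optimalCost A B C A := by
    have := dist_add_le_optimalCost (S := A) hBmem hCmem (m := c) (by rw [← hc])
      (by rw [← hb']; exact hbc)
    rwa [← ha] at this
  -- For a start on `CA` the roles of `a` and `b` are exchanged, which puts `4 * a` in the
  -- denominator.
  have hbound : ∀ x : ℝ, x = 4 * b ∨ x = 4 * a →
      ((a + b) ^ 2 - c ^ 2 + 4 * Real.sqrt 3 * τ₀) / x ≤
        ((a + b) ^ 2 - c ^ 2 + 4 * Real.sqrt 3 * τ) / (4 * b) := by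
    intro x hx
    have h1 : 0 ≤ (a + b) ^ 2 - c ^ 2 + 4 * Real.sqrt 3 * τ₀ := by
      have : 0 ≤ 4 * Real.sqrt 3 * τ₀ := by positivity
      nlinarith
    have h2 : 4 * Real.sqrt 3 * τ₀ ≤ 4 * Real.sqrt 3 * τ := by gcongr
    apply div_le_div₀ (by linarith) (by linarith) (by linarith)
    rcases hx with rfl | rfl <;> linarith
  have hhalf_area := (half_perimeter_le_area_bound ha0 hb0 hc0 hab hbc htri hτ0 hheron).trans
    (hbound _ (Or.inl rfl))
  have hcostC : optimalCost A B C C ≤ ENNReal.ofReal (b + c) := by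
    have := optimalCost_vertex_le hAB.symm hCA.symm hBC.symm (by rw [← ha', ← hb']; exact hab)
    rwa [hswap, ← hb', ← hc'] at this
  have hlongest : ∀ i, ∀ S ∈ edge A B C i,
      optimalCost A B C S ≤ ENNReal.ofReal (a + (b + c) / 2) := by
    intro i S hS
    fin_cases i
    · refine (optimalCost_le_of_longest (m := a) hAB hBC hCA ha.ge (by linarith) (by linarith)
        hS).trans (ENNReal.ofReal_le_ofReal ?_)
      linarith
    · rw [← hrot']
      refine (optimalCost_le_of_longest (m := a) hBC hCA hAB (by linarith) (by linarith) ha.ge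
        hS).trans (ENNReal.ofReal_le_ofReal ?_)
      linarith
    · rw [← hrot]
      refine (optimalCost_le_of_longest (m := a) hCA hAB hBC (by linarith) ha.ge (by linarith)
        hS).trans (ENNReal.ofReal_le_ofReal ?_)
      linarith
  have hshortest : ∀ S ∈ edge A B C 2, optimalCost A B C S ≤ ENNReal.ofReal (a + c) := by
    intro S hS
    have := optimalCost_le_of_mem_shortest hCA hAB hBC (by linarith) (by linarith) hS
    rwa [hrot, ← ha, ← hc, add_comm] at this
  refine ⟨le_antisymm ?_ ?_, ⟨?_, ?_⟩, ⟨?_, ?_⟩, ⟨?_, ?_⟩⟩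
  · exact iInf_le_of_le 2 (iInf₂_le_of_le S₂ hS₂ hS₂')
  · exact le_iInf fun i => le_iInf₂ fun S _ => hhalf S
  · exact le_iSup_of_le 0 (le_iInf₂ fun S _ => hhalf S)
  · rw [hmin]
    refine le_min (iSup_le fun i => ?_) (iSup_le fun i => ?_)
    · fin_cases i
      · exact iInf₂_le_of_le C (right_mem_segment ℝ B C) hcostC
      · exact iInf₂_le_of_le C (left_mem_segment ℝ C A) hcostC
      · exact iInf₂_le_of_le S₂ hS₂ (hS₂'.trans (ENNReal.ofReal_le_ofReal (by linarith)))
    · fin_cases i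
      · obtain ⟨S, hS, hS'⟩ := exists_optimalCost_le_area hAB hBC hCA
          (by rw [← ha, ← hb, ← hc]; nlinarith) (by rw [← ha, ← hb, ← hc]; exact hobt)
          (by rw [← ha, ← hb, ← hc]; nlinarith) hτ0 (by rw [← ha, ← hb, ← hc]; exact hheron)
        rw [← ha, ← hb, ← hc] at hS'
        exact iInf₂_le_of_le S hS (hS'.trans (ENNReal.ofReal_le_ofReal (hbound _ (Or.inl rfl))))
      -- The angle at `B` is compared with 60°.
      · rcases le_total (a ^ 2 + c ^ 2 - b ^ 2) (a * c) with h | h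
        · obtain ⟨S, hS, hS'⟩ := exists_optimalCost_le_area hAB.symm hCA.symm hBC.symm
            (by rw [← ha', ← hb', ← hc']; exact h) (by rw [← ha', ← hb', ← hc']; nlinarith)
            (by rw [← ha', ← hb', ← hc']; nlinarith) hτ0
            (by rw [← ha', ← hb', ← hc', hheron]; ring)
          rw [← ha', ← hb', ← hc', hswap, add_comm b a] at hS'
          exact iInf₂_le_of_le S (by rw [segment_symm] at hS; exact hS)
            (hS'.trans (ENNReal.ofReal_le_ofReal (hbound _ (Or.inr rfl))))
        · obtain ⟨S, hS, hS'⟩ := exists_optimalCost_le_half_perimeter hAB.symm hCA.symm hBC.symm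
            (by rw [← ha', ← hc']; linarith) (by rw [← ha', ← hb', ← hc']; exact h)
          rw [← ha', ← hb', ← hc', hswap, add_comm b a] at hS'
          exact iInf₂_le_of_le S (by rw [segment_symm] at hS; exact hS)
            (hS'.trans (ENNReal.ofReal_le_ofReal hhalf_area))
      · exact iInf₂_le_of_le S₂ hS₂ (hS₂'.trans (ENNReal.ofReal_le_ofReal hhalf_area))
  · rw [hmin]
    refine le_iInf fun i => ?_
    fin_cases i
    · obtain ⟨S, hS, hS1, hS2⟩ := exists_mem_segment_dist_eq (X := A) hBC
        (by rw [← ha, ← hc]; linarith)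
      have := dist_add_le_optimalCost (S := S) hCmem hAmem hS2 le_rfl
      rw [hS1, ← ha, ← hb, ← hb', ← hc, add_comm b] at this
      exact (min_le_left _ _).trans (le_iSup₂_of_le S hS this)
    · exact (min_le_right _ _).trans (le_iSup₂_of_le A (right_mem_segment ℝ C A) hvertexA)
    · exact (min_le_right _ _).trans (le_iSup₂_of_le A (left_mem_segment ℝ A B) hvertexA)
  · rw [hmin]
    have h2 : lowerU A B C ≤ ENNReal.ofReal (a + c) := iInf_le_of_le 2 (iSup₂_le hshortest)
    refine le_min ?_ h2
    -- This decides which term of the minimum is smaller, and with it whether the algorithm picks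
    -- the longest or the shortest edge.
    rcases le_total b ((a + c) / 2) with h | h
    · refine iInf_le_of_le 0 (iSup₂_le fun S hS => ?_)
      have := optimalCost_le_of_mem_longest hAB hBC hCA (by linarith) (by linarith)
        -- Since the triangle is not obtuse and `c ≤ b`, `a² ≤ b² + c² ≤ (b + c / 2)²`.
        (by rw [← ha, ← hb, ← hc]; exact abs_le_of_sq_le_sq' (by nlinarith) (by linarith) |>.2) hS
      rwa [← ha, ← hb, ← hc] at this
    · exact h2.trans (ENNReal.ofReal_le_ofReal (by linarith))
  · obtain ⟨S, hS, hS1, hS2⟩ := exists_mem_segment_dist_eq (X := B) hCA.symm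
      (by rw [← hb', ← hc']; exact hbc)
    have := dist_add_le_optimalCost (S := S) hCmem hBmem hS2 le_rfl
    rw [hS1, ← ha, ← ha', ← hb', ← hc'] at this
    exact le_iSup_of_le 1 (le_iSup₂_of_le S (by rw [segment_symm] at hS; exact hS) this)
  · exact iSup_le fun i => iSup₂_le (hlongest i)
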